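/- **Setting.** Let $n,\tau\ge 1$ and $d\ge 0$ be integers and $L,\sigma>0$. Each agent $i=1,\dots,n$ has a loss $F_i:\mathbb R^d\times\Xi_i\to\mathbb R$, differentiable in its first argument $x$ with $\nabla F_i(x;\xi)$ (the gradient in $x$) jointly measurable, and a probability distribution $P_i$ on $\Xi_i$ such that $f_i(x)=\mathbb E_{\xi_i\sim P_i}[F_i(x;\xi_i)]$ is finite for all $x$. Let $f=\frac1n\sum_{i=1}^n f_i$. *Smoothness.* Each $f_i$ is continuously differentiable with $\|\nabla f_i(x)-\nabla f_i(y)\|\le L\|x-y\|$ for all $x,y\in\mathbb R^d$, and $f$ is bounded below; $f^*=\inf f$. *Finite-time consensus.* $W^{(0)},\dots,W^{(\tau-1)}\in\mathbb R^{n\times n}$ are doubly stochastic and $W^{(\tau-1)}\cdots W^{(1)}W^{(0)}=\frac1n\mathbf 1\mathbf 1^{\mathsf T}$. *Algorithm (GT-FT).* Let $\alpha>0$. From initial points $x_i^{(0)}$ (possibly random, with finite second moments, and then independent of the samples $\xi_j^{(l)}$, $l\ge 0$, $1\le j\le n$, introduced below) and $g_i^{(0)}=\nabla F_i(x_i^{(0)};\xi_i^{(0)})$,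 iterate for $k\ge 0$, with $w_{ij}^{(k)}=W^{(k\bmod\tau)}_{ij}$, $$x_i^{(k+1)}=\sum_{j=1}^n w^{(k)}_{ij}\bigl(x_j^{(k)}-\alpha g_j^{(k)}\bigr),\qquad g_i^{(k+1)}=\sum_{j=1}^n w^{(k)}_{ij}g_j^{(k)}+\nabla F_i(x_i^{(k+1)};\xi_i^{(k+1)})-\nabla F_i(x_i^{(k)};\xi_i^{(k)}).$$ *Noise.* The samples $\xi_i^{(k)}$ ($k\ge0$, $1\le i\le n$) are mutually independent random variables with values in $\Xi_i$. With $\mathcal F^{(k)}$ the $\sigma$-algebra generated by $(x_i^{(l)})_{0\le l\le k,\,1\le i\le n}$, for all $k$ and $i$ the error $\nabla F_i(x_i^{(k)};\xi_i^{(k)})-\nabla f_i(x_i^{(k)})$ is square integrable, and almost surely $$\mathbb E[\nabla F_i(x_i^{(k)};\xi_i^{(k)})\mid\mathcal F^{(k)}]=\nabla f_i(x_i^{(k)}),\qquad \mathbb E[\|\nabla F_i(x_i^{(k)};\xi_i^{(k)})-\nabla f_i(x_i^{(k)})\|^2\mid\mathcal F^{(k)}]\le\sigma^2 .$$ Write $\bar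 x^{(k)}=\frac1n\sum_i x_i^{(k)}$ and $\overline{\nabla f}(\mathbf x^{(k)})=\frac1n\sum_i\nabla f_i(x_i^{(k)})$. **Theorem.** There are absolute constants $c,\gamma_2,\gamma_3>0$ such that, in every such setting with $0<\alpha\le\frac{1}{4\sqrt3\,\tau^2L}$, the random variables $\|\overline{\nabla f}(\mathbf x^{(k)})\|^2$ and $\|\nabla f(\bar x^{(k)})\|^2$ are integrable for all $k\ge0$, and for every constant $\gamma_1>0$ with $$\gamma_1\ \ge\ c\left(\frac{\mathbb E f(\bar x^{(0)})-f^*}{\alpha\tau^2L^2}+\frac{1}{\tau}\cdot\frac1n\sum_{i=1}^n\mathbb E\|x_i^{(0)}-\bar x^{(0)}\|^2+\alpha^2\tau\cdot\frac1n\sum_{i=1}^n\mathbb E\bigl\|\nabla f_i(x_i^{(0)})-\overline{\nabla f}(\mathbf x^{(0)})\bigr\|^2\right)$$ and every integer $T\ge\tau$, $$\frac1{T+1}\sum_{k=0}^{T}\Bigl(\mathbb E\|\overline{\nabla f}(\mathbf x^{(k)})\|^2+\mathbb E\|\nabla f(\bar x^{(k)})\|^2\Bigr)\le\frac{\gamma_1\tau^2L^2}{T}+\frac{\gamma_2\sigma^2}{\tau}+\frac{\gamma_3\sigma^2}{\tau^2n}.$$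 In particular $\gamma_1$ depends only on $L$, $\tau$, $\alpha$ and the initial data, not on $T$, $\sigma$ or the mixing matrices, so the bound does not depend on the connectivity of any individual graph in the sequence. -/

import Mathlib

open MeasureTheory ProbabilityTheory

noncomputable section

namespace GTFT

/-- The space `ℝ^d` with its Euclidean norm. -/
abbrev Vec (d : ℕ) : Type := EuclideanSpace ℝ (Fin d)

/-- The average `(1/n) ∑ i, v i` of one vector per agent. -/
def avg {n d : ℕ} (v : Fin n → Vec d) : Vec d := (n : ℝ)⁻¹ • ∑ i, v i

/-- The matrices `W 0, …, W (τ - 1)` are doubly stochastic and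
`W (τ - 1) * ⋯ * W 1 * W 0 = (1/n) 𝟙 𝟙ᵀ`. Only the entries `W l` with `l < τ` matter. -/
structure FiniteTimeConsensus {n : ℕ} (τ : ℕ) (W : ℕ → Matrix (Fin n) (Fin n) ℝ) : Prop where
  one_le : 1 ≤ τ
  doublyStochastic : ∀ l < τ, W l ∈ doublyStochastic ℝ (Fin n)
  prod_eq : ((List.range τ).reverse.map W).prod = Matrix.of fun _ _ => (n : ℝ)⁻¹

/-- The local objective `f_i(x) = E[F_i(x; ξ_i)]`, where `ξ_i` has law `P i`. -/
def localObj {n d : ℕ} {Ξ : Fin n → Type*} [∀ i, MeasurableSpace (Ξ i)]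
    (P : ∀ i, Measure (Ξ i)) (F : ∀ i, Vec d → Ξ i → ℝ) (i : Fin n) (x : Vec d) : ℝ :=
  ∫ z, F i x z ∂(P i)

/-- The global objective `f(x) = (1/n) ∑ i, f_i(x)`. -/
def globalObj {n d : ℕ} (f : Fin n → Vec d → ℝ) (x : Vec d) : ℝ :=
  (n : ℝ)⁻¹ * ∑ i, f i x

/-- The stochastic gradient `∇F_i(x; z)`, the gradient being taken in `x`. -/
def stochGrad {n d : ℕ} {Ξ : Fin n → Type*} (F : ∀ i, Vec d → Ξ i → ℝ)
    (i : Fin n) (x : Vec d) (z : Ξ i) : Vec d :=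
  gradient (fun y => F i y z) x

/-- `(W ⊗ I_d) v`: agent `i` receives `∑ j, W i j • v j`. -/
def mix {n d : ℕ} (W : Matrix (Fin n) (Fin n) ℝ) (v : Fin n → Vec d) : Fin n → Vec d :=
  fun i => ∑ j, W i j • v j

/-- The pair `(x^(k), g^(k))` of parameters and tracking variables of GT-FT, along one
realisation `z` of the samples: `g^(0) = ∇F(x^(0); z^(0))` and
`x^(k+1) = W^(k mod τ) (x^(k) - α g^(k))`,
`g^(k+1) = W^(k mod τ) g^(k) + ∇F(x^(k+1); z^(k+1)) - ∇F(x^(k); z^(k))`. -/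
def state {n d : ℕ} {Ξ : Fin n → Type*} (F : ∀ i, Vec d → Ξ i → ℝ) (τ : ℕ)
    (W : ℕ → Matrix (Fin n) (Fin n) ℝ) (α : ℝ) (x₀ : Fin n → Vec d)
    (z : ℕ → ∀ i, Ξ i) : ℕ → (Fin n → Vec d) × (Fin n → Vec d)
  | 0 => (x₀, fun i => stochGrad F i (x₀ i) (z 0 i))
  | k + 1 =>
    let s := state F τ W α x₀ z k
    let x' := mix (W (k % τ)) fun i => s.1 i - α • s.2 i
    (x', fun i => mix (W (k % τ)) s.2 i
      + stochGrad F i (x' i) (z (k + 1) i) - stochGrad F i (s.1 i) (z k i))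

/-- The random parameters `x_i^(k)` generated by GT-FT from the random initial points `x₀` and
the random samples `ξ`. -/
def iter {n d : ℕ} {Ξ : Fin n → Type*} {Ω : Type*} (F : ∀ i, Vec d → Ξ i → ℝ) (τ : ℕ)
    (W : ℕ → Matrix (Fin n) (Fin n) ℝ) (α : ℝ) (x₀ : Fin n → Ω → Vec d)
    (ξ : ℕ → ∀ i, Ω → Ξ i) (k : ℕ) (ω : Ω) : Fin n → Vec d :=
  (state F τ W α (fun i => x₀ i ω) (fun j i => ξ j i ω) k).1

/-- The `σ`-algebra generated by `x^(0), …, x^(k)`. -/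
abbrev history {n d : ℕ} {Ω : Type*} (x : ℕ → Ω → Fin n → Vec d) (k : ℕ) : MeasurableSpace Ω :=
  ⨆ j ∈ Set.Iic k, MeasurableSpace.comap (x j) inferInstance

/-- Every `f_i` is continuously differentiable with `L`-Lipschitz gradient, and `f` is bounded
below. -/
structure SmoothBelow {n d : ℕ} (f : Fin n → Vec d → ℝ) (L : ℝ) : Prop where
  contDiff : ∀ i, ContDiff ℝ 1 (f i)
  lipschitz : ∀ i x y, ‖gradient (f i) x - gradient (f i) y‖ ≤ L * ‖x - y‖
  bddBelow : BddBelow (Set.range (globalObj f))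

/-- The loss functions `F_i(·; z)` are differentiable, their stochastic gradients are jointly
measurable, and `f_i(x) = E[F_i(x; ξ_i)]` is a convergent expectation. -/
structure LossRegular {n d : ℕ} {Ξ : Fin n → Type*} [∀ i, MeasurableSpace (Ξ i)]
    (P : ∀ i, Measure (Ξ i)) (F : ∀ i, Vec d → Ξ i → ℝ) : Prop where
  differentiable : ∀ i z, Differentiable ℝ fun x => F i x z
  measurable_grad : ∀ i, Measurable fun p : Vec d × Ξ i => stochGrad F i p.1 p.2
  integrable : ∀ i x, Integrable (F i x) (P i)

/-- The initial points are random vectors with finite second moments, independent of the samples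
(deterministic initial points are a special case). -/
structure InitialCondition {n d : ℕ} {Ξ : Fin n → Type*} [∀ i, MeasurableSpace (Ξ i)]
    {Ω : Type*} [MeasurableSpace Ω] (μ : Measure Ω) (x₀ : Fin n → Ω → Vec d)
    (ξ : ℕ → ∀ i, Ω → Ξ i) : Prop where
  measurable : ∀ i, Measurable (x₀ i)
  memLp : ∀ i, MemLp (x₀ i) 2 μ
  indep : IndepFun (fun ω i => x₀ i ω) (fun ω (p : ℕ × Fin n) => ξ p.1 p.2 ω) μ

/-- The assumption on the stochastic gradients along the random sequence `x`: all samples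
`ξ_i^(k)` are mutually independent, and conditionally on `x^(0), …, x^(k)` the stochastic gradient
`∇F_i(x_i^(k); ξ_i^(k))` is unbiased for `∇f_i(x_i^(k))` with variance at most `σ²`.
(`sqIntegrable` makes the conditional variance a genuine, finite conditional expectation.) -/
structure NoiseAssumption {n d : ℕ} {Ξ : Fin n → Type*} [∀ i, MeasurableSpace (Ξ i)]
    {Ω : Type*} [MeasurableSpace Ω] (μ : Measure Ω) (F : ∀ i, Vec d → Ξ i → ℝ)
    (f : Fin n → Vec d → ℝ) (ξ : ℕ → ∀ i, Ω → Ξ i) (x : ℕ → Ω → Fin n → Vec d) (σ : ℝ) :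
    Prop where
  measurable : ∀ k i, Measurable (ξ k i)
  indep : iIndepFun (fun (p : ℕ × Fin n) => ξ p.1 p.2) μ
  sqIntegrable : ∀ k i, MemLp
    (fun ω => stochGrad F i (x k ω i) (ξ k i ω) - gradient (f i) (x k ω i)) 2 μ
  unbiased : ∀ k i,
    μ[fun ω => stochGrad F i (x k ω i) (ξ k i ω) | history x k]
      =ᵐ[μ] fun ω => gradient (f i) (x k ω i)
  variance : ∀ k i,
    μ[fun ω => ‖stochGrad F i (x k ω i) (ξ k i ω) - gradient (f i) (x k ω i)‖ ^ 2 | history x k]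
      ≤ᵐ[μ] fun _ => σ ^ 2

/-- `E f(x̄^(0)) - inf f`. -/
def initialGap {n d : ℕ} {Ω : Type*} [MeasurableSpace Ω] (μ : Measure Ω)
    (f : Fin n → Vec d → ℝ) (x₀ : Fin n → Ω → Vec d) : ℝ :=
  (∫ ω, globalObj f (avg fun i => x₀ i ω) ∂μ) - ⨅ y, globalObj f y

/-- `(1/n) ∑ i, E ‖x_i^(0) - x̄^(0)‖²`. -/
def initialDisagreement {n d : ℕ} {Ω : Type*} [MeasurableSpace Ω] (μ : Measure Ω)
    (x₀ : Fin n → Ω → Vec d) : ℝ :=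
  (n : ℝ)⁻¹ * ∑ i, ∫ ω, ‖x₀ i ω - avg fun j => x₀ j ω‖ ^ 2 ∂μ

/-- `(1/n) ∑ i, E ‖∇f_i(x_i^(0)) - (1/n) ∑ j, ∇f_j(x_j^(0))‖²`. -/
def initialGradSpread {n d : ℕ} {Ω : Type*} [MeasurableSpace Ω] (μ : Measure Ω)
    (f : Fin n → Vec d → ℝ) (x₀ : Fin n → Ω → Vec d) : ℝ :=
  (n : ℝ)⁻¹ * ∑ i, ∫ ω,
    ‖gradient (f i) (x₀ i ω) - avg fun j => gradient (f j) (x₀ j ω)‖ ^ 2 ∂μ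

end GTFT

end

/-! Each stacked iterate splits into its average and its disagreement `center n d x`. Gradient
tracking keeps the average of `g` equal to the average of the sampled gradients, so the average
iterate makes an inexact gradient step for `globalObj f`. `SmoothBelow.descent` then bounds the sum
`S` of both squared gradients by the initial gap, by `L ^ 2 / n` times the accumulated squared
disagreement, and by noise.

The disagreement obeys a linear recursion with the operators `W (k % τ) - (1/n) 𝟙 𝟙ᵀ`. Finite-time
consensus makes their product over an aligned window zero, so any `2 τ` consecutive operators
multiply to zero (`transition_eq_zero`): memory is finite, and no spectral gap enters.
`tracking_solution` writes the disagreement as a convolution of gradient increments with weights `m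
- j`, supported on `m - j < 2 τ`.

The increments have two parts, treated differently in `sum_sq_disagreement_le`. Increments of exact
gradients are Lipschitz in the iterates; the Schur test (kernel mass at most `2 τ ^ 2`) makes them
cost a multiple of `(α L τ ^ 2) ^ 2` times the disagreement itself, and the step size lets this be
absorbed. Increments of noise are summed by parts and become orthogonal terms, so the squares of the
weights add up to order `τ ^ 3`, instead of the order `τ ^ 4` of the squared sum of weights. Since
`α L τ ^ 2` is bounded, `α ^ 2 L ^ 2 τ ^ 3 σ ^ 2` is of order `σ ^ 2 / τ`.

Orthogonality is needed against the whole past, including earlier samples, whereas unbiasedness is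
only given relative to the iterates; `integral_inner_eq_zero_of_indepFun` bridges this by
independence of the samples. -/

noncomputable section

namespace GTFT

/-! ### Linear recursions with finite memory: solution formula and deterministic bounds. -/

section Dynamics

variable {H : Type*} [NormedAddCommGroup H] [InnerProductSpace ℝ H]

/-- The product `A (j + s - 1) ∘ ⋯ ∘ A j` of `s` consecutive operators starting at time `j`. -/
def transition (A : ℕ → H →L[ℝ] H) (j : ℕ) : ℕ → H →L[ℝ] H
  | 0 => ContinuousLinearMap.id ℝ H
  | s + 1 => (A (j + s)).comp (transition A j s)

theorem transition_add (A : ℕ → H →L[ℝ] H) (j s t : ℕ) :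
    transition A j (s + t) = (transition A (j + s) t).comp (transition A j s) := by
  induction t with
  | zero => ext; simp [transition]
  | succ t ih =>
    rw [← Nat.add_assoc]
    simp only [transition, ih, Nat.add_assoc, ContinuousLinearMap.comp_assoc]

theorem norm_transition_le {A : ℕ → H →L[ℝ] H} (hA : ∀ k v, ‖A k v‖ ≤ ‖v‖) (j s : ℕ) (v : H) :
    ‖transition A j s v‖ ≤ ‖v‖ := by
  induction s with
  | zero => simp [transition]
  | succ s ih => exact (hA _ _).trans ih

theorem transition_eq_zero_of_le {A : ℕ → H →L[ℝ] H} {j s t r : ℕ}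
    (h : transition A (j + s) t = 0) (hr : s + t ≤ r) : transition A j r = 0 := by
  obtain ⟨q, rfl⟩ := Nat.exists_eq_add_of_le hr
  rw [transition_add, transition_add, h]
  simp

/-- If every aligned window of length `τ` has product zero, then so has every window of length
at least `2 τ`. -/
theorem transition_eq_zero {A : ℕ → H →L[ℝ] H} {τ : ℕ} (hτ : 1 ≤ τ)
    (h : ∀ t, transition A (t * τ) τ = 0) (j r : ℕ) (hr : 2 * τ ≤ r) : transition A j r = 0 := by
  have h1 := Nat.div_add_mod j τ
  have h2 := Nat.mod_lt j (show 0 < τ by omega)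
  -- The next multiple of `τ` after `j`; the aligned window starting there ends within `2 τ` steps
  -- of `j`.
  have h3 : j + (τ - j % τ) = (j / τ + 1) * τ := by
    have : (j / τ + 1) * τ = τ * (j / τ) + τ := by ring
    omega
  refine transition_eq_zero_of_le (s := τ - j % τ) (t := τ) ?_ (by omega)
  rw [h3]
  exact h _

theorem transition_succ_sub (A : ℕ → H →L[ℝ] H) {j m : ℕ} (hj : j ≤ m) :
    transition A j (m + 1 - j) = (A m).comp (transition A j (m - j)) := by
  rw [Nat.succ_sub hj]
  simp only [transition]
  rw [Nat.add_sub_cancel' hj]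

/-- Solution formula of the recursion of gradient tracking. -/
theorem tracking_solution {A : ℕ → H →L[ℝ] H} {α : ℝ} {y h v : ℕ → H}
    (hy : ∀ k, y (k + 1) = A k (y k - α • h k)) (h0 : h 0 = v 0)
    (hh : ∀ k, h (k + 1) = A k (h k) + v (k + 1)) (m : ℕ) :
    y m = transition A 0 m (y 0)
      - α • ∑ j ∈ Finset.range m, ((m - j : ℕ) : ℝ) • transition A j (m - j) (v j) := by
  -- The input `v j` sits in `h` at each of the times `j, …, m - 1` and is passed to `y` at each of
  -- them. Whatever the time of passage, it is transported by the same full product, hence the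
  -- factor `m - j`.
  have hsol : ∀ k, h k = ∑ j ∈ Finset.range (k + 1), transition A j (k - j) (v j) := by
    intro k
    induction k with
    | zero => simp [transition, h0]
    | succ k ih =>
      rw [hh, ih, Finset.sum_range_succ _ (k + 1), map_sum]
      congr 1
      · refine Finset.sum_congr rfl fun j hj => ?_
        rw [transition_succ_sub A (by simpa [Nat.lt_succ_iff] using hj)]
        rfl
      · simp [transition]
  induction m with
  | zero => simp [transition]
  | succ m ih =>
    rw [hy, map_sub, map_smul, hsol, ih, map_sub, map_smul, map_sum, map_sum, sub_sub, ← smul_add]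
    congr 2
    · simp
    · rw [Finset.sum_range_succ, Finset.sum_range_succ, ← add_assoc, ← Finset.sum_add_distrib]
      congr 1
      · refine Finset.sum_congr rfl fun j hj => ?_
        have hj' : j ≤ m := (Finset.mem_range.1 hj).le
        rw [transition_succ_sub A hj', Nat.succ_sub hj', map_smul]
        push_cast
        rw [add_smul, one_smul]
        rfl
      · rw [transition_succ_sub A le_rfl, Nat.succ_sub le_rfl]
        simp

/-- The increments of a sequence, the first one being its initial value. -/
def increment (u : ℕ → H) : ℕ → H
  | 0 => u 0
  | k + 1 => u (k + 1) - u k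

/-- The operator by which the noise at time `j` enters the disagreement at time `m`. -/
def noiseOp (A : ℕ → H →L[ℝ] H) (m j : ℕ) : H →L[ℝ] H :=
  ((m - j : ℕ) : ℝ) • transition A j (m - j)
    - ((m - (j + 1) : ℕ) : ℝ) • transition A (j + 1) (m - (j + 1))

theorem sum_apply_increment (C : ℕ → H →L[ℝ] H) (u : ℕ → H) (m : ℕ) :
    ∑ j ∈ Finset.range (m + 1), C j (increment u j)
      = ∑ j ∈ Finset.range (m + 1), (C j - C (j + 1)) (u j) + C (m + 1) (u m) := by
  induction m with
  | zero => simp [increment]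
  | succ m ih =>
    rw [Finset.sum_range_succ, ih, Finset.sum_range_succ _ (m + 1)]
    simp only [increment, map_sub, sub_apply]
    abel

/-- Summation by parts; the boundary term carries the weight `m - m = 0`. Successive noise
increments share a term and are correlated, whereas the noises `u j` themselves will be orthogonal.
-/
theorem sum_increment_eq_sum_noiseOp (A : ℕ → H →L[ℝ] H) (u : ℕ → H) (m : ℕ) :
    ∑ j ∈ Finset.range m, ((m - j : ℕ) : ℝ) • transition A j (m - j) (increment u j)
      = ∑ j ∈ Finset.range m, noiseOp A m j (u j) := by
  cases m with
  | zero => simp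
  | succ m =>
    have := sum_apply_increment
      (fun j => ((m + 1 - j : ℕ) : ℝ) • transition A j (m + 1 - j)) u m
    simpa [noiseOp] using this

theorem noiseOp_eq_zero {A : ℕ → H →L[ℝ] H} {τ : ℕ}
    (h : ∀ j r, 2 * τ ≤ r → transition A j r = 0) {m j : ℕ} (hj : 2 * τ + 1 ≤ m - j) :
    noiseOp A m j = 0 := by
  rw [noiseOp, h j (m - j) (by omega), h (j + 1) (m - (j + 1)) (by omega)]
  simp

theorem norm_noiseOp_le {A : ℕ → H →L[ℝ] H} (hA : ∀ k v, ‖A k v‖ ≤ ‖v‖) (m j : ℕ) (v : H) :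
    ‖noiseOp A m j v‖ ≤ 2 * ((m - j : ℕ) : ℝ) * ‖v‖ := by
  have h1 : ((m - (j + 1) : ℕ) : ℝ) ≤ ((m - j : ℕ) : ℝ) := by
    exact_mod_cast Nat.sub_le_sub_left (Nat.le_succ j) m
  calc ‖noiseOp A m j v‖
      ≤ ‖((m - j : ℕ) : ℝ) • transition A j (m - j) v‖
        + ‖((m - (j + 1) : ℕ) : ℝ) • transition A (j + 1) (m - (j + 1)) v‖ := norm_sub_le _ _
    _ ≤ ((m - j : ℕ) : ℝ) * ‖v‖ + ((m - j : ℕ) : ℝ) * ‖v‖ := by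
        rw [norm_smul, norm_smul, Real.norm_natCast, Real.norm_natCast]
        gcongr
        · exact norm_transition_le hA _ _ _
        · exact norm_transition_le hA _ _ _
    _ = _ := by ring

/-- With `φ` equal to `m - j` in either variable, this bounds both the row and the column sums of a
convolution kernel. -/
theorem sum_comp_le_sum_range {ι : Type*} {κ : ℕ → ℝ} {M : ℕ} (h0 : ∀ s, 0 ≤ κ s)
    (hM : ∀ s, M ≤ s → κ s = 0) (S : Finset ι) (φ : ι → ℕ) (hφ : Set.InjOn φ S) :
    ∑ i ∈ S, κ (φ i) ≤ ∑ s ∈ Finset.range M, κ s := by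
  classical
  rw [← Finset.sum_image (f := κ) hφ,
    ← Finset.sum_filter_add_sum_filter_not (S.image φ) (· < M)]
  rw [Finset.sum_eq_zero (s := (S.image φ).filter (fun x => ¬ x < M))
    (fun s hs => hM s (not_lt.1 (Finset.mem_filter.1 hs).2)), add_zero]
  refine Finset.sum_le_sum_of_subset_of_nonneg (fun s hs => ?_) (fun s _ _ => h0 s)
  exact Finset.mem_range.2 (Finset.mem_filter.1 hs).2

/-- Schur test for a finitely supported convolution kernel on `ℕ`. -/
theorem sum_sq_convolution_le {κ : ℕ → ℝ} {M : ℕ} {K : ℝ} (h0 : ∀ s, 0 ≤ κ s)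
    (hM : ∀ s, M ≤ s → κ s = 0) (hK : ∑ s ∈ Finset.range M, κ s ≤ K) (a : ℕ → ℝ) (N : ℕ) :
    ∑ m ∈ Finset.range N, (∑ j ∈ Finset.range m, κ (m - j) * a j) ^ 2
      ≤ K ^ 2 * ∑ j ∈ Finset.range N, a j ^ 2 := by
  have hK0 : 0 ≤ K := (Finset.sum_nonneg fun s _ => h0 s).trans hK
  -- Cauchy–Schwarz with weights `κ (m - j)`; the row mass gives one factor `K`, the column mass
  -- after exchanging sums the other.
  have hrow : ∀ m, (∑ j ∈ Finset.range m, κ (m - j) * a j) ^ 2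
      ≤ K * ∑ j ∈ Finset.range m, κ (m - j) * a j ^ 2 := by
    intro m
    refine (Finset.sum_sq_le_sum_mul_sum_of_sq_le_mul (Finset.range m)
      (f := fun j => κ (m - j)) (g := fun j => κ (m - j) * a j ^ 2)
      (fun j _ => h0 _) (fun j _ => mul_nonneg (h0 _) (sq_nonneg _))
      (fun j _ => le_of_eq (by ring))).trans ?_
    refine mul_le_mul_of_nonneg_right ?_
      (Finset.sum_nonneg fun j _ => mul_nonneg (h0 _) (sq_nonneg _))
    refine (sum_comp_le_sum_range h0 hM (Finset.range m) (fun j => m - j) ?_).trans hK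
    intro i hi j hj hij
    simp only [Finset.coe_range, Set.mem_Iio] at hi hj hij
    omega
  calc ∑ m ∈ Finset.range N, (∑ j ∈ Finset.range m, κ (m - j) * a j) ^ 2
      ≤ ∑ m ∈ Finset.range N, K * ∑ j ∈ Finset.range m, κ (m - j) * a j ^ 2 :=
        Finset.sum_le_sum fun m _ => hrow m
    _ = K * ∑ j ∈ Finset.range N, ∑ m ∈ Finset.Ioo j N, κ (m - j) * a j ^ 2 := by
        rw [← Finset.mul_sum]
        congr 1
        refine Finset.sum_comm' fun m j => ?_
        simp only [Finset.mem_range, Finset.mem_Ioo]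
        omega
    _ ≤ K * ∑ j ∈ Finset.range N, K * a j ^ 2 := by
        refine mul_le_mul_of_nonneg_left (Finset.sum_le_sum fun j _ => ?_) hK0
        rw [← Finset.sum_mul]
        refine mul_le_mul_of_nonneg_right ?_ (sq_nonneg _)
        refine (sum_comp_le_sum_range h0 hM (Finset.Ioo j N) (fun m => m - j) ?_).trans hK
        intro i hi i' hi' hij
        simp only [Finset.coe_Ioo, Set.mem_Ioo] at hi hi' hij
        omega
    _ = _ := by rw [← Finset.mul_sum]; ring

/-- Schur test with the kernel `s` cut off at `2 τ`, whose mass is at most `2 τ ^ 2`. -/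
theorem sum_sq_transition_le {A : ℕ → H →L[ℝ] H} {τ : ℕ} (hA : ∀ k v, ‖A k v‖ ≤ ‖v‖)
    (h : ∀ j r, 2 * τ ≤ r → transition A j r = 0) (w : ℕ → H) (N : ℕ) :
    ∑ m ∈ Finset.range N,
        ‖∑ j ∈ Finset.range m, ((m - j : ℕ) : ℝ) • transition A j (m - j) (w j)‖ ^ 2
      ≤ 4 * (τ : ℝ) ^ 4 * ∑ j ∈ Finset.range N, ‖w j‖ ^ 2 := by
  set κ : ℕ → ℝ := fun s => if s < 2 * τ then (s : ℝ) else 0 with hκ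
  have h0 : ∀ s, 0 ≤ κ s := fun s => by simp only [hκ]; split_ifs <;> positivity
  have hM : ∀ s, 2 * τ ≤ s → κ s = 0 := fun s hs => by simp [hκ, not_lt.2 hs]
  have hK : ∑ s ∈ Finset.range (2 * τ), κ s ≤ 2 * (τ : ℝ) ^ 2 := by
    have h1 : ∑ s ∈ Finset.range (2 * τ), κ s = ((∑ s ∈ Finset.range (2 * τ), s : ℕ) : ℝ) := by
      push_cast
      exact Finset.sum_congr rfl fun s hs => by simp only [hκ, if_pos (Finset.mem_range.1 hs)]
    have h2 := Finset.sum_range_id_mul_two (2 * τ)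
    have h3 : (∑ s ∈ Finset.range (2 * τ), s) * 2 ≤ 2 * τ * (2 * τ) := by
      rw [h2]; exact Nat.mul_le_mul_left _ (Nat.sub_le _ _)
    have h4 : ((∑ s ∈ Finset.range (2 * τ), s : ℕ) : ℝ) * 2 ≤ 2 * τ * (2 * τ) := by
      exact_mod_cast h3
    rw [h1]
    linarith
  refine le_trans (Finset.sum_le_sum fun m _ => ?_)
    ((sum_sq_convolution_le h0 hM hK (fun j => ‖w j‖) N).trans (le_of_eq (by ring)))
  refine pow_le_pow_left₀ (norm_nonneg _) ((norm_sum_le _ _).trans ?_) 2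
  refine Finset.sum_le_sum fun j _ => ?_
  by_cases hs : m - j < 2 * τ
  · rw [norm_smul, Real.norm_natCast]
    simp only [hκ, if_pos hs]
    gcongr
    exact norm_transition_le hA _ _ _
  · rw [h j (m - j) (not_lt.1 hs)]
    simp [hM _ (not_lt.1 hs)]

theorem sum_range_succ_sq_le (N : ℕ) :
    ∑ s ∈ Finset.range (N + 1), (s : ℝ) ^ 2 ≤ (N : ℝ) ^ 3 := by
  induction N with
  | zero => simp
  | succ N ih =>
    rw [Finset.sum_range_succ]
    push_cast
    have : (0 : ℝ) ≤ N := N.cast_nonneg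
    nlinarith

/-- Total weight of the noise in the disagreement. -/
theorem sum_sq_noise_weight_le {τ : ℕ} (m : ℕ) :
    ∑ j ∈ Finset.range m, (if m - j < 2 * τ + 1 then (2 * ((m - j : ℕ) : ℝ)) ^ 2 else 0)
      ≤ 32 * (τ : ℝ) ^ 3 := by
  set κ : ℕ → ℝ := fun s => if s < 2 * τ + 1 then (2 * (s : ℝ)) ^ 2 else 0 with hκ
  have h0 : ∀ s, 0 ≤ κ s := fun s => by simp only [hκ]; split_ifs <;> positivity
  have hM : ∀ s, 2 * τ + 1 ≤ s → κ s = 0 := fun s hs => by simp only [hκ, if_neg (not_lt.2 hs)]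
  refine (sum_comp_le_sum_range h0 hM (Finset.range m) (fun j => m - j) ?_).trans ?_
  · intro i hi j hj hij
    simp only [Finset.coe_range, Set.mem_Iio] at hi hj hij
    omega
  · have h1 : ∑ s ∈ Finset.range (2 * τ + 1), κ s
        = 4 * ∑ s ∈ Finset.range (2 * τ + 1), (s : ℝ) ^ 2 := by
      rw [Finset.mul_sum]
      refine Finset.sum_congr rfl fun s hs => ?_
      simp only [hκ, if_pos (Finset.mem_range.1 hs)]
      ring
    have h2 := sum_range_succ_sq_le (2 * τ)
    push_cast at h2
    rw [h1]
    nlinarith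

theorem norm_add_sq_le_two (a b : H) : ‖a + b‖ ^ 2 ≤ 2 * ‖a‖ ^ 2 + 2 * ‖b‖ ^ 2 := by
  have := parallelogram_law_with_norm ℝ a b
  nlinarith [sq_nonneg ‖a - b‖]

theorem norm_sub_sq_le_two (a b : H) : ‖a - b‖ ^ 2 ≤ 2 * ‖a‖ ^ 2 + 2 * ‖b‖ ^ 2 := by
  have := parallelogram_law_with_norm ℝ a b
  nlinarith [sq_nonneg ‖a + b‖]

/-- Accumulated disagreement of gradient tracking along one realisation of the noise `b`. -/
theorem sum_sq_disagreement_le {A : ℕ → H →L[ℝ] H} {τ : ℕ} {α L : ℝ} {y h a b : ℕ → H}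
    {q : ℕ → ℝ} (hA : ∀ k v, ‖A k v‖ ≤ ‖v‖) (h2 : ∀ j r, 2 * τ ≤ r → transition A j r = 0)
    (h1 : ∀ r, τ ≤ r → transition A 0 r = 0) (hstep : 48 * (α ^ 2 * L ^ 2 * (τ : ℝ) ^ 4) ≤ 1)
    (hy : ∀ k, y (k + 1) = A k (y k - α • h k)) (h0 : h 0 = a 0 + b 0)
    (hh : ∀ k, h (k + 1) = A k (h k) + ((a (k + 1) + b (k + 1)) - (a k + b k)))
    (hq : ∀ k, 0 ≤ q k)
    (ha : ∀ k, ‖a (k + 1) - a k‖ ^ 2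
      ≤ L ^ 2 * (2 * ‖y (k + 1)‖ ^ 2 + 2 * ‖y k‖ ^ 2 + α ^ 2 * q k)) (N : ℕ) :
    ∑ m ∈ Finset.range N, ‖y m‖ ^ 2
      ≤ α ^ 2 / 2 * ∑ m ∈ Finset.range N, q m
        + 24 * (τ * ‖y 0‖ ^ 2 + α ^ 2 * (τ : ℝ) ^ 3 * ‖a 0‖ ^ 2)
        + 12 * α ^ 2 * ∑ m ∈ Finset.range N,
            ‖∑ j ∈ Finset.range m, noiseOp A m j (b j)‖ ^ 2 := by
  -- The increment at time `0` is `a 0` itself, which no Lipschitz bound controls; it is moved to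
  -- the initial part `I`.
  set w : ℕ → H := fun j => if j = 0 then 0 else increment a j with hw
  set D : ℕ → H := fun m =>
    ∑ j ∈ Finset.range m, ((m - j : ℕ) : ℝ) • transition A j (m - j) (w j) with hD
  set B : ℕ → H := fun m => ∑ j ∈ Finset.range m, noiseOp A m j (b j) with hB
  set I : ℕ → H := fun m => transition A 0 m (y 0) - α • (m : ℝ) • transition A 0 m (a 0) with hI
  have hdec : ∀ m, y m = (I m - α • B m) - α • D m := by
    intro m
    have hs := tracking_solution (v := increment fun k => a k + b k) hy h0 (by simpa [increment])
      m
    have hsum : ∑ j ∈ Finset.range m, ((m - j : ℕ) : ℝ) • transition A j (m - j)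
          (increment (fun k => a k + b k) j)
        = (m : ℝ) • transition A 0 m (a 0) + D m + B m := by
      have e1 : ∀ j, increment (fun k => a k + b k) j
          = (if j = 0 then a 0 else 0) + w j + increment b j := by
        intro j
        cases j with
        | zero => simp [increment, hw]
        | succ j => simp only [increment, hw, Nat.succ_ne_zero, if_false]; abel
      simp only [e1, map_add, smul_add, Finset.sum_add_distrib, sum_increment_eq_sum_noiseOp]
      congr 2
      cases m with
      | zero => simp
      | succ m =>
        rw [Finset.sum_range_succ']
        simp
    rw [hs, hsum]
    simp only [hI, smul_add]
    abel
  have hpt : ∀ m, ‖y m‖ ^ 2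
      ≤ 2 * α ^ 2 * ‖D m‖ ^ 2 + 4 * ‖I m‖ ^ 2 + 4 * α ^ 2 * ‖B m‖ ^ 2 := by
    intro m
    have e1 := norm_sub_sq_le_two (I m - α • B m) (α • D m)
    have e2 := norm_sub_sq_le_two (I m) (α • B m)
    rw [← hdec m] at e1
    simp only [norm_smul, mul_pow, Real.norm_eq_abs, sq_abs] at e1 e2
    linarith
  -- Time `0` is aligned, so the initial data are forgotten after `τ` steps rather than `2 τ`.
  have hIsum : ∑ m ∈ Finset.range N, ‖I m‖ ^ 2
      ≤ 2 * (τ * ‖y 0‖ ^ 2 + α ^ 2 * (τ : ℝ) ^ 3 * ‖a 0‖ ^ 2) := by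
    set κ : ℕ → ℝ := fun m => if m < τ then 2 * (‖y 0‖ ^ 2 + α ^ 2 * (τ : ℝ) ^ 2 * ‖a 0‖ ^ 2) else 0
      with hκ
    have hle : ∀ m, ‖I m‖ ^ 2 ≤ κ m := by
      intro m
      by_cases hm : m < τ
      · have e1 := norm_sub_sq_le_two (transition A 0 m (y 0))
          (α • (m : ℝ) • transition A 0 m (a 0))
        simp only [norm_smul, mul_pow, Real.norm_eq_abs, sq_abs] at e1
        simp only [hκ, if_pos hm, hI]
        refine e1.trans ?_
        have e2 : (m : ℝ) ≤ τ := by exact_mod_cast hm.le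
        have e3 := norm_transition_le hA 0 m (y 0)
        have e4 := norm_transition_le hA 0 m (a 0)
        calc _ ≤ 2 * ‖y 0‖ ^ 2 + 2 * (α ^ 2 * ((τ : ℝ) ^ 2 * ‖a 0‖ ^ 2)) := by gcongr
          _ = _ := by ring
      · simp [hκ, hI, if_neg hm, h1 m (not_lt.1 hm)]
    refine (Finset.sum_le_sum fun m _ => hle m).trans ?_
    refine (sum_comp_le_sum_range (M := τ) (fun s => ?_) (fun s hs => ?_) (Finset.range N) id
      Function.injective_id.injOn).trans ?_
    · simp only [hκ]; split_ifs <;> positivity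
    · simp [hκ, not_lt.2 hs]
    · have e1 : ∀ s ∈ Finset.range τ, κ s = 2 * (‖y 0‖ ^ 2 + α ^ 2 * (τ : ℝ) ^ 2 * ‖a 0‖ ^ 2) :=
        fun s hs => by simp only [hκ, if_pos (Finset.mem_range.1 hs)]
      rw [Finset.sum_congr rfl e1, Finset.sum_const, Finset.card_range, nsmul_eq_mul]
      exact le_of_eq (by ring)
  have hwsum : ∑ j ∈ Finset.range N, ‖w j‖ ^ 2
      ≤ L ^ 2 * (4 * ∑ m ∈ Finset.range N, ‖y m‖ ^ 2 + α ^ 2 * ∑ m ∈ Finset.range N, q m) := by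
    cases N with
    | zero => simp
    | succ N =>
      rw [Finset.sum_range_succ']
      have e1 : ∑ j ∈ Finset.range N, ‖w (j + 1)‖ ^ 2
          ≤ ∑ j ∈ Finset.range N,
            L ^ 2 * (2 * ‖y (j + 1)‖ ^ 2 + 2 * ‖y j‖ ^ 2 + α ^ 2 * q j) :=
        Finset.sum_le_sum fun j _ => by simpa [hw, increment] using ha j
      have e2 : ∑ j ∈ Finset.range N, ‖y (j + 1)‖ ^ 2 ≤ ∑ m ∈ Finset.range (N + 1), ‖y m‖ ^ 2 := by
        rw [Finset.sum_range_succ']; exact le_add_of_nonneg_right (sq_nonneg _)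
      have e3 : ∑ j ∈ Finset.range N, ‖y j‖ ^ 2 ≤ ∑ m ∈ Finset.range (N + 1), ‖y m‖ ^ 2 := by
        rw [Finset.sum_range_succ]; exact le_add_of_nonneg_right (sq_nonneg _)
      have e4 : ∑ j ∈ Finset.range N, q j ≤ ∑ m ∈ Finset.range (N + 1), q m := by
        rw [Finset.sum_range_succ]; exact le_add_of_nonneg_right (hq _)
      have e5 : ‖w 0‖ ^ 2 = 0 := by simp [hw]
      rw [e5, add_zero]
      refine e1.trans ?_
      rw [← Finset.mul_sum, Finset.sum_add_distrib, Finset.sum_add_distrib, ← Finset.mul_sum,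
        ← Finset.mul_sum, ← Finset.mul_sum]
      refine mul_le_mul_of_nonneg_left ?_ (sq_nonneg _)
      have := mul_le_mul_of_nonneg_left e4 (sq_nonneg α)
      linarith
  have hDsum := sum_sq_transition_le hA h2 w N
  set SY := ∑ m ∈ Finset.range N, ‖y m‖ ^ 2
  set SQ := ∑ m ∈ Finset.range N, q m
  have hSY : 0 ≤ SY := Finset.sum_nonneg fun _ _ => sq_nonneg _
  have hSQ : 0 ≤ SQ := Finset.sum_nonneg fun _ _ => hq _
  have hmain : SY ≤ 2 * α ^ 2 * ∑ m ∈ Finset.range N, ‖D m‖ ^ 2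
      + 4 * ∑ m ∈ Finset.range N, ‖I m‖ ^ 2 + 4 * α ^ 2 * ∑ m ∈ Finset.range N, ‖B m‖ ^ 2 := by
    rw [Finset.mul_sum, Finset.mul_sum, Finset.mul_sum, ← Finset.sum_add_distrib,
      ← Finset.sum_add_distrib]
    exact Finset.sum_le_sum fun m _ => hpt m
  -- The step size gives `8 α² L² τ⁴ ≤ 1 / 6`. The drift thus costs `2 / 3` of `SY`; absorbing it
  -- multiplies the other terms by `3`.
  have hdrift : 2 * α ^ 2 * ∑ m ∈ Finset.range N, ‖D m‖ ^ 2 ≤ 1 / 6 * (4 * SY + α ^ 2 * SQ) := by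
    calc 2 * α ^ 2 * ∑ m ∈ Finset.range N, ‖D m‖ ^ 2
        ≤ 2 * α ^ 2 * (4 * (τ : ℝ) ^ 4 * (L ^ 2 * (4 * SY + α ^ 2 * SQ))) := by
          refine mul_le_mul_of_nonneg_left (hDsum.trans ?_) (by positivity)
          exact mul_le_mul_of_nonneg_left hwsum (by positivity)
      _ = 8 * (α ^ 2 * L ^ 2 * (τ : ℝ) ^ 4) * (4 * SY + α ^ 2 * SQ) := by ring
      _ ≤ _ := by
          refine mul_le_mul_of_nonneg_right (by linarith) (by positivity)
  linarith

end Dynamics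

/-! ### Doubly stochastic mixing, the disagreement projection and the tracking recursion. -/

section Mixing

variable {n d : ℕ}

/-- The space of stacked vectors, one per agent, with its Euclidean norm. -/
abbrev Stack (n d : ℕ) : Type := PiLp 2 fun _ : Fin n => Vec d

/-- The operator `W ⊗ I_d` on stacked vectors. -/
def mixL (W : Matrix (Fin n) (Fin n) ℝ) : Stack n d →L[ℝ] Stack n d :=
  ((PiLp.continuousLinearEquiv 2 ℝ fun _ : Fin n => Vec d).symm : (Fin n → Vec d) →L[ℝ] _).comp
    (ContinuousLinearMap.pi fun i => ∑ j, W i j • PiLp.proj 2 (fun _ : Fin n => Vec d) j)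

theorem mixL_apply (W : Matrix (Fin n) (Fin n) ℝ) (v : Stack n d) (i : Fin n) :
    mixL W v i = ∑ j, W i j • v j := by
  simp [mixL]

theorem mixL_toLp (W : Matrix (Fin n) (Fin n) ℝ) (v : Fin n → Vec d) :
    mixL W (WithLp.toLp 2 v) = WithLp.toLp 2 (mix W v) := by
  ext1 i
  simp [mixL_apply, mix]

theorem mixL_mul (A B : Matrix (Fin n) (Fin n) ℝ) :
    (mixL (A * B) : Stack n d →L[ℝ] Stack n d) = (mixL A).comp (mixL B) := by
  ext1 v
  ext1 i
  simp only [mixL_apply, ContinuousLinearMap.comp_apply, Matrix.mul_apply, Finset.sum_smul,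
    Finset.smul_sum, mul_smul]
  exact Finset.sum_comm

theorem mixL_sub (A B : Matrix (Fin n) (Fin n) ℝ) :
    (mixL (A - B) : Stack n d →L[ℝ] Stack n d) = mixL A - mixL B := by
  ext1 v
  ext1 i
  simp [mixL_apply, sub_smul]

/-- The matrix `(1/n) 𝟙 𝟙ᵀ`. -/
def avgMatrix (n : ℕ) : Matrix (Fin n) (Fin n) ℝ := Matrix.of fun _ _ => (n : ℝ)⁻¹

theorem mixL_avgMatrix_apply (v : Stack n d) (i : Fin n) :
    mixL (avgMatrix n) v i = avg v.ofLp := by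
  simp [mixL_apply, avgMatrix, avg, Finset.smul_sum]

theorem mul_avgMatrix {W : Matrix (Fin n) (Fin n) ℝ} (hW : W ∈ doublyStochastic ℝ (Fin n)) :
    W * avgMatrix n = avgMatrix n := by
  ext i j
  simp [Matrix.mul_apply, avgMatrix, ← Finset.sum_mul, sum_row_of_mem_doublyStochastic hW]

theorem avgMatrix_mul {W : Matrix (Fin n) (Fin n) ℝ} (hW : W ∈ doublyStochastic ℝ (Fin n)) :
    avgMatrix n * W = avgMatrix n := by
  ext i j
  simp [Matrix.mul_apply, avgMatrix, ← Finset.mul_sum, sum_col_of_mem_doublyStochastic hW]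

theorem avgMatrix_mul_self (hn : 0 < n) : avgMatrix n * avgMatrix n = avgMatrix n := by
  have : (n : ℝ) ≠ 0 := by positivity
  ext i j
  simp [Matrix.mul_apply, avgMatrix, this]

/-- Unit row sums give Jensen's inequality for each agent; unit column sums then collapse the sum
over agents. -/
theorem norm_mixL_le {W : Matrix (Fin n) (Fin n) ℝ} (hW : W ∈ doublyStochastic ℝ (Fin n))
    (v : Stack n d) : ‖mixL W v‖ ≤ ‖v‖ := by
  refine le_of_sq_le_sq ?_ (norm_nonneg _)
  rw [PiLp.norm_sq_eq_of_L2, PiLp.norm_sq_eq_of_L2]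
  have h0 : ∀ i j, 0 ≤ W i j := fun i j => nonneg_of_mem_doublyStochastic hW
  calc ∑ i, ‖mixL W v i‖ ^ 2 ≤ ∑ i, ∑ j, W i j * ‖v j‖ ^ 2 := by
        refine Finset.sum_le_sum fun i _ => ?_
        have h1 : ‖mixL W v i‖ ≤ ∑ j, W i j * ‖v j‖ := by
          rw [mixL_apply]
          refine (norm_sum_le _ _).trans (Finset.sum_le_sum fun j _ => ?_)
          rw [norm_smul, Real.norm_of_nonneg (h0 i j)]
        have h2 := Finset.sum_sq_le_sum_mul_sum_of_sq_le_mul Finset.univ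
          (r := fun j => W i j * ‖v j‖) (f := fun j => W i j) (g := fun j => W i j * ‖v j‖ ^ 2)
          (fun j _ => h0 i j) (fun j _ => mul_nonneg (h0 i j) (sq_nonneg _))
          (fun j _ => le_of_eq (by ring))
        rw [sum_row_of_mem_doublyStochastic hW, one_mul] at h2
        exact (pow_le_pow_left₀ (norm_nonneg _) h1 2).trans h2
    _ = ∑ j, ‖v j‖ ^ 2 := by
        rw [Finset.sum_comm]
        refine Finset.sum_congr rfl fun j _ => ?_
        rw [← Finset.sum_mul, sum_col_of_mem_doublyStochastic hW, one_mul]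

/-- The disagreement component `v - (1/n) 𝟙 𝟙ᵀ v` of a stacked vector. -/
def center (n d : ℕ) : Stack n d →L[ℝ] Stack n d :=
  ContinuousLinearMap.id ℝ _ - mixL (avgMatrix n)

theorem center_apply (v : Stack n d) (i : Fin n) : center n d v i = v i - avg v.ofLp := by
  simp [center, mixL_avgMatrix_apply]

theorem sum_eq_smul_avg (hn : 0 < n) (v : Fin n → Vec d) : ∑ i, v i = (n : ℝ) • avg v := by
  have : (n : ℝ) ≠ 0 := by positivity
  simp [avg, smul_smul, this]

theorem norm_sq_eq_center_add_avg (hn : 0 < n) (v : Stack n d) :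
    ‖v‖ ^ 2 = ‖center n d v‖ ^ 2 + n * ‖avg v.ofLp‖ ^ 2 := by
  rw [PiLp.norm_sq_eq_of_L2, PiLp.norm_sq_eq_of_L2]
  have h1 : ∑ i, inner ℝ (v i) (avg v.ofLp) = n * ‖avg v.ofLp‖ ^ 2 := by
    rw [← sum_inner, sum_eq_smul_avg hn, inner_smul_left, real_inner_self_eq_norm_sq]
    simp
  simp only [center_apply, norm_sub_sq_real]
  rw [Finset.sum_add_distrib, Finset.sum_sub_distrib, ← Finset.mul_sum, h1]
  simp
  ring

theorem norm_center_le (hn : 0 < n) (v : Stack n d) : ‖center n d v‖ ≤ ‖v‖ := by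
  refine le_of_sq_le_sq ?_ (norm_nonneg _)
  rw [norm_sq_eq_center_add_avg hn v]
  exact le_add_of_nonneg_right (by positivity)

theorem norm_avg_sq_le (hn : 0 < n) (v : Stack n d) :
    n * ‖avg v.ofLp‖ ^ 2 ≤ ‖v‖ ^ 2 := by
  rw [norm_sq_eq_center_add_avg hn v]
  exact le_add_of_nonneg_left (by positivity)

theorem mixL_sub_avgMatrix_eq {W : Matrix (Fin n) (Fin n) ℝ}
    (hW : W ∈ doublyStochastic ℝ (Fin n)) (v : Stack n d) :
    mixL (W - avgMatrix n) v = mixL W (center n d v) := by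
  have : mixL W (mixL (avgMatrix n) v) = mixL (avgMatrix n) v := by
    rw [← ContinuousLinearMap.comp_apply, ← mixL_mul, mul_avgMatrix hW]
  simp [center, mixL_sub, this]

theorem norm_mixL_sub_avgMatrix_le {W : Matrix (Fin n) (Fin n) ℝ} (hn : 0 < n)
    (hW : W ∈ doublyStochastic ℝ (Fin n)) (v : Stack n d) :
    ‖mixL (W - avgMatrix n) v‖ ≤ ‖v‖ := by
  rw [mixL_sub_avgMatrix_eq hW]
  exact (norm_mixL_le hW _).trans (norm_center_le hn v)

/-- The average is fixed by `W` from both sides, so the disagreement evolves on its own. -/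
theorem center_mixL {W : Matrix (Fin n) (Fin n) ℝ} (hn : 0 < n)
    (hW : W ∈ doublyStochastic ℝ (Fin n)) (v : Stack n d) :
    center n d (mixL W v) = mixL (W - avgMatrix n) (center n d v) := by
  have h1 : mixL W (mixL (avgMatrix n) v) = mixL (avgMatrix n) v := by
    rw [← ContinuousLinearMap.comp_apply, ← mixL_mul, mul_avgMatrix hW]
  have h2 : mixL (avgMatrix n) (mixL W v) = mixL (avgMatrix n) v := by
    rw [← ContinuousLinearMap.comp_apply, ← mixL_mul, avgMatrix_mul hW]
  have h3 : mixL (avgMatrix n) (mixL (avgMatrix n) v) = mixL (avgMatrix n) v := by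
    rw [← ContinuousLinearMap.comp_apply, ← mixL_mul, avgMatrix_mul_self hn]
  simp [center, mixL_sub, h1, h2, h3]

theorem avg_mixL {W : Matrix (Fin n) (Fin n) ℝ} (hW : W ∈ doublyStochastic ℝ (Fin n))
    (v : Stack n d) : avg (mixL W v).ofLp = avg v.ofLp := by
  simp only [avg]
  congr 1
  have : ∀ i, (mixL W v).ofLp i = ∑ j, W i j • v j := mixL_apply W v
  simp only [this]
  rw [Finset.sum_comm]
  refine Finset.sum_congr rfl fun j _ => ?_
  rw [← Finset.sum_smul, sum_col_of_mem_doublyStochastic hW, one_smul]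

theorem avg_add (v w : Fin n → Vec d) : avg (v + w) = avg v + avg w := by
  simp [avg, Finset.sum_add_distrib]

theorem avg_sub (v w : Fin n → Vec d) : avg (v - w) = avg v - avg w := by
  simp [avg, Finset.sum_sub_distrib, smul_sub]

theorem avg_smul (c : ℝ) (v : Fin n → Vec d) : avg (c • v) = c • avg v := by
  simp [avg, ← Finset.smul_sum, smul_comm c]

theorem prod_range_succ_reverse (W : ℕ → Matrix (Fin n) (Fin n) ℝ) (s : ℕ) :
    ((List.range (s + 1)).reverse.map W).prod = W s * ((List.range s).reverse.map W).prod := by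
  simp [List.range_succ]

theorem avgMatrix_mul_prod {τ : ℕ} {W : ℕ → Matrix (Fin n) (Fin n) ℝ}
    (hW : ∀ l < τ, W l ∈ doublyStochastic ℝ (Fin n)) {s : ℕ} (hs : s ≤ τ) :
    avgMatrix n * ((List.range s).reverse.map W).prod = avgMatrix n := by
  induction s with
  | zero => simp
  | succ s ih =>
    rw [prod_range_succ_reverse, ← mul_assoc, avgMatrix_mul (hW s hs), ih (by omega)]

/-- Every cross term in the product of the `W l - avgMatrix n` reduces to `avgMatrix n`. The length
is `s + 1` because the empty product is the identity, without `avgMatrix n` subtracted. -/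
theorem transition_window_eq {τ : ℕ} {W : ℕ → Matrix (Fin n) (Fin n) ℝ} (hn : 0 < n)
    (hW : ∀ l < τ, W l ∈ doublyStochastic ℝ (Fin n)) (t s : ℕ) (hs : s + 1 ≤ τ) :
    transition (fun k => (mixL (W (k % τ) - avgMatrix n) : Stack n d →L[ℝ] Stack n d)) (t * τ)
      (s + 1) = mixL (((List.range (s + 1)).reverse.map W).prod - avgMatrix n) := by
  have hmod : ∀ s, s < τ → (t * τ + s) % τ = s := fun s hs => by
    rw [Nat.add_comm, Nat.add_mul_mod_self_right, Nat.mod_eq_of_lt hs]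
  induction s with
  | zero =>
    have := hmod 0 (by omega)
    simp only [Nat.add_zero] at this
    simp [transition, this]
  | succ s ih =>
    have e := avgMatrix_mul_prod hW (s := s + 1) (by omega)
    rw [transition, ih (by omega), hmod (s + 1) (by omega), ← mixL_mul,
      prod_range_succ_reverse W (s + 1), sub_mul, mul_sub, mul_sub, mul_avgMatrix (hW _ hs), e,
      avgMatrix_mul_self hn]
    congr 1
    abel

theorem FiniteTimeConsensus.transition_window {τ : ℕ} {W : ℕ → Matrix (Fin n) (Fin n) ℝ}
    (hn : 0 < n) (hW : FiniteTimeConsensus τ W) (t : ℕ) :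
    transition (fun k => (mixL (W (k % τ) - avgMatrix n) : Stack n d →L[ℝ] Stack n d)) (t * τ) τ
      = 0 := by
  obtain ⟨s, rfl⟩ := Nat.exists_eq_add_of_le' hW.one_le
  rw [transition_window_eq hn hW.doublyStochastic t s le_rfl, hW.prod_eq]
  ext1 v
  ext1 i
  simp [mixL_apply, avgMatrix]

theorem FiniteTimeConsensus.mod_mem {τ : ℕ} {W : ℕ → Matrix (Fin n) (Fin n) ℝ}
    (hW : FiniteTimeConsensus τ W) (k : ℕ) : W (k % τ) ∈ _root_.doublyStochastic ℝ (Fin n) :=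
  hW.doublyStochastic _ (Nat.mod_lt _ hW.one_le)

/-- The disagreement dynamics of gradient tracking with the mixing matrices `W (k % τ)`. -/
abbrev disagreementOp (d : ℕ) (τ : ℕ) (W : ℕ → Matrix (Fin n) (Fin n) ℝ) (k : ℕ) :
    Stack n d →L[ℝ] Stack n d :=
  mixL (W (k % τ) - avgMatrix n)

/-- Stacked recursion of gradient tracking driven by the gradient estimates `s`. -/
structure IsTracking (τ : ℕ) (W : ℕ → Matrix (Fin n) (Fin n) ℝ) (α : ℝ)
    (x g s : ℕ → Stack n d) : Prop where
  x_succ : ∀ k, x (k + 1) = mixL (W (k % τ)) (x k - α • g k)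
  g_zero : g 0 = s 0
  g_succ : ∀ k, g (k + 1) = mixL (W (k % τ)) (g k) + (s (k + 1) - s k)

/-- The tracking property: mixing preserves averages, and the added differences of `s` telescope
from `g 0 = s 0`. -/
theorem IsTracking.avg_g {τ : ℕ} {W : ℕ → Matrix (Fin n) (Fin n) ℝ} {α : ℝ}
    {x g s : ℕ → Stack n d} (h : IsTracking τ W α x g s) (hW : FiniteTimeConsensus τ W) (k : ℕ) :
    avg (g k).ofLp = avg (s k).ofLp := by
  induction k with
  | zero => rw [h.g_zero]
  | succ k ih =>
    rw [h.g_succ, WithLp.ofLp_add, WithLp.ofLp_sub, avg_add, avg_sub, avg_mixL (hW.mod_mem k), ih]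
    abel

theorem IsTracking.avg_x {τ : ℕ} {W : ℕ → Matrix (Fin n) (Fin n) ℝ} {α : ℝ}
    {x g s : ℕ → Stack n d} (h : IsTracking τ W α x g s) (hW : FiniteTimeConsensus τ W) (k : ℕ) :
    avg (x (k + 1)).ofLp = avg (x k).ofLp - α • avg (s k).ofLp := by
  rw [h.x_succ, avg_mixL (hW.mod_mem k), WithLp.ofLp_sub, WithLp.ofLp_smul, avg_sub, avg_smul,
    h.avg_g hW]

theorem IsTracking.sum_sq_center_le {τ : ℕ} {W : ℕ → Matrix (Fin n) (Fin n) ℝ} {α L : ℝ}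
    {x g s a : ℕ → Stack n d} (h : IsTracking τ W α x g s) (hn : 0 < n)
    (hW : FiniteTimeConsensus τ W) (hstep : 48 * (α ^ 2 * L ^ 2 * (τ : ℝ) ^ 4) ≤ 1)
    (ha : ∀ k, ‖a (k + 1) - a k‖ ^ 2 ≤ L ^ 2 * ‖x (k + 1) - x k‖ ^ 2) (N : ℕ) :
    ∑ m ∈ Finset.range N, ‖center n d (x m)‖ ^ 2
      ≤ α ^ 2 / 2 * ∑ m ∈ Finset.range N, n * ‖avg (s m).ofLp‖ ^ 2
        + 24 * (τ * ‖center n d (x 0)‖ ^ 2 + α ^ 2 * (τ : ℝ) ^ 3 * ‖center n d (a 0)‖ ^ 2)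
        + 12 * α ^ 2 * ∑ m ∈ Finset.range N,
            ‖∑ j ∈ Finset.range m,
              noiseOp (disagreementOp d τ W) m j (center n d (s j - a j))‖ ^ 2 := by
  have hwin := hW.transition_window (d := d) hn
  refine sum_sq_disagreement_le (L := L) (h := fun k => center n d (g k))
    (y := fun k => center n d (x k)) (a := fun k => center n d (a k))
    (b := fun k => center n d (s k - a k))
    (q := fun k => n * ‖avg (s k).ofLp‖ ^ 2) (fun k v => ?_)
    (transition_eq_zero hW.one_le hwin) (fun r hr => ?_) hstep
    (fun k => ?_) ?_ (fun k => ?_) (fun k => by positivity) (fun k => ?_) N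
  · exact norm_mixL_sub_avgMatrix_le hn (hW.mod_mem k) v
  · refine transition_eq_zero_of_le (s := 0) (t := τ) ?_ (by omega)
    simpa using hwin 0
  · rw [h.x_succ, center_mixL hn (hW.mod_mem k), map_sub, map_smul]
  · rw [h.g_zero, ← map_add]
    congr 1
    abel
  · rw [h.g_succ, map_add, center_mixL hn (hW.mod_mem k), ← map_add, ← map_add, ← map_sub]
    congr 2
    abel
  · simp only
    rw [← map_sub]
    refine (pow_le_pow_left₀ (norm_nonneg _) (norm_center_le hn _) 2).trans ((ha k).trans ?_)
    refine mul_le_mul_of_nonneg_left ?_ (sq_nonneg L)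
    -- Pythagoras splits the move of the iterates into disagreement and average; the average moves
    -- by exactly `-α • avg (s k)`, which produces the term `α ^ 2 * q k`.
    rw [norm_sq_eq_center_add_avg hn (x (k + 1) - x k), WithLp.ofLp_sub, avg_sub, h.avg_x hW,
      map_sub, sub_sub_cancel_left, norm_neg, norm_smul, mul_pow, Real.norm_eq_abs, sq_abs]
    have := norm_sub_sq_le_two (center n d (x (k + 1))) (center n d (x k))
    linarith

end Mixing

/-! ### Smoothness and the one-step descent inequality. -/

section Smooth

/-- Quadratic upper bound for a function with Lipschitz gradient. -/
theorem le_of_lipschitz_gradient {E : Type*} [NormedAddCommGroup E] [InnerProductSpace ℝ E]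
    [CompleteSpace E] {f : E → ℝ} {L : ℝ} (hf : Differentiable ℝ f)
    (hL : ∀ x y, ‖gradient f x - gradient f y‖ ≤ L * ‖x - y‖) (x v : E) :
    f (x + v) ≤ f x + inner ℝ (gradient f x) v + L / 2 * ‖v‖ ^ 2 := by
  -- Subtracting the linear and quadratic terms along the segment leaves a function whose derivative
  -- is nonpositive by the Lipschitz bound.
  set φ : ℝ → ℝ := fun t =>
    f (x + t • v) - t * inner ℝ (gradient f x) v - L / 2 * ‖v‖ ^ 2 * t ^ 2 with hφ
  have hder : ∀ t, HasDerivAt φ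
      (inner ℝ (gradient f (x + t • v)) v - inner ℝ (gradient f x) v - L * ‖v‖ ^ 2 * t) t := by
    intro t
    have h1 : HasDerivAt (fun t : ℝ => x + t • v) v t := by
      simpa using ((hasDerivAt_id t).smul_const v).const_add x
    have h2 : HasDerivAt (fun t : ℝ => f (x + t • v)) (inner ℝ (gradient f (x + t • v)) v) t := by
      have := (hf (x + t • v)).hasFDerivAt.comp_hasDerivAt t h1
      rwa [← inner_gradient_left] at this
    have h3 := (h2.sub ((hasDerivAt_id t).mul_const (inner ℝ (gradient f x) v))).sub
      ((hasDerivAt_pow 2 t).const_mul (L / 2 * ‖v‖ ^ 2))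
    refine h3.congr_deriv ?_
    simp
    ring
  have hanti : AntitoneOn φ (Set.Icc 0 1) := by
    refine antitoneOn_of_deriv_nonpos (convex_Icc 0 1)
      (fun t _ => (hder t).continuousAt.continuousWithinAt)
      (fun t _ => (hder t).differentiableAt.differentiableWithinAt) fun t ht => ?_
    rw [interior_Icc] at ht
    rw [(hder t).deriv, ← inner_sub_left]
    have h1 := real_inner_le_norm (gradient f (x + t • v) - gradient f x) v
    have h2 := hL (x + t • v) x
    rw [add_sub_cancel_left, norm_smul, Real.norm_of_nonneg ht.1.le] at h2
    have h3 := mul_le_mul_of_nonneg_right h2 (norm_nonneg v)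
    nlinarith
  have h01 := hanti (Set.left_mem_Icc.2 zero_le_one) (Set.right_mem_Icc.2 zero_le_one) zero_le_one
  simp only [hφ, one_smul, zero_smul, add_zero] at h01
  linarith

variable {n d : ℕ} {f : Fin n → Vec d → ℝ} {L : ℝ}

theorem hasGradientAt_globalObj (hf : ∀ i, Differentiable ℝ (f i)) (x : Vec d) :
    HasGradientAt (globalObj f) (avg fun i => gradient (f i) x) x := by
  rw [hasGradientAt_iff_hasFDerivAt]
  have h := (HasFDerivAt.fun_sum (u := Finset.univ) fun i _ =>
    hasGradientAt_iff_hasFDerivAt.1 (hf i x).hasGradientAt).const_mul ((n : ℝ)⁻¹)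
  refine h.congr_fderiv ?_
  simp [avg, map_sum]

theorem SmoothBelow.differentiable (h : SmoothBelow f L) (i : Fin n) : Differentiable ℝ (f i) :=
  (h.contDiff i).differentiable one_ne_zero

theorem SmoothBelow.gradient_globalObj (h : SmoothBelow f L) (x : Vec d) :
    gradient (globalObj f) x = avg fun i => gradient (f i) x :=
  (hasGradientAt_globalObj h.differentiable x).gradient

theorem norm_avg_le (hn : 0 < n) {v : Fin n → Vec d} {c : ℝ} (hv : ∀ i, ‖v i‖ ≤ c) :
    ‖avg v‖ ≤ c := by
  have hn' : (0 : ℝ) < n := by exact_mod_cast hn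
  rw [avg, norm_smul, norm_inv, Real.norm_natCast, inv_mul_le_iff₀ hn']
  refine (norm_sum_le_of_le _ fun i _ => hv i).trans ?_
  simp

theorem SmoothBelow.lipschitz_globalObj (h : SmoothBelow f L) (hn : 0 < n) (x y : Vec d) :
    ‖gradient (globalObj f) x - gradient (globalObj f) y‖ ≤ L * ‖x - y‖ := by
  rw [h.gradient_globalObj, h.gradient_globalObj, ← avg_sub]
  exact norm_avg_le hn fun i => h.lipschitz i x y

/-- The stacked gradients of the local objectives. -/
def gradStack (f : Fin n → Vec d → ℝ) (x : Stack n d) : Stack n d :=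
  WithLp.toLp 2 fun i => gradient (f i) (x i)

theorem SmoothBelow.norm_gradStack_sub_le (h : SmoothBelow f L) (x y : Stack n d) :
    ‖gradStack f x - gradStack f y‖ ^ 2 ≤ L ^ 2 * ‖x - y‖ ^ 2 := by
  rw [PiLp.norm_sq_eq_of_L2, PiLp.norm_sq_eq_of_L2, Finset.mul_sum]
  refine Finset.sum_le_sum fun i _ => ?_
  rw [← mul_pow]
  exact pow_le_pow_left₀ (norm_nonneg _) (h.lipschitz i (x i) (y i)) 2

/-- `gradient (globalObj f)` at the mean is the average of `gradStack f` at the stack with every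
entry equal to the mean, and this stack differs from `x` by the disagreement. -/
theorem SmoothBelow.norm_gradient_sub_avg_le (h : SmoothBelow f L) (hn : 0 < n) (x : Stack n d) :
    n * ‖gradient (globalObj f) (avg x.ofLp) - avg (gradStack f x).ofLp‖ ^ 2
      ≤ L ^ 2 * ‖center n d x‖ ^ 2 := by
  have h1 := norm_avg_sq_le hn
    (gradStack f (WithLp.toLp 2 fun _ => avg x.ofLp) - gradStack f x)
  rw [WithLp.ofLp_sub, avg_sub] at h1
  have h2 : avg (gradStack f (WithLp.toLp 2 fun _ => avg x.ofLp)).ofLp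
      = gradient (globalObj f) (avg x.ofLp) := (h.gradient_globalObj _).symm
  rw [h2] at h1
  refine h1.trans ((h.norm_gradStack_sub_le _ _).trans (le_of_eq ?_))
  rw [← norm_neg]
  congr 3
  ext1 i
  simp [center_apply]

/-- One step of the average of gradient tracking decreases the objective up to disagreement and
noise. -/
theorem SmoothBelow.descent (h : SmoothBelow f L) (hn : 0 < n) (hL : 0 < L) {α : ℝ} (hα : 0 < α)
    (x e : Stack n d) :
    α / 2 * (‖avg (gradStack f x).ofLp‖ ^ 2 + ‖gradient (globalObj f) (avg x.ofLp)‖ ^ 2)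
      ≤ globalObj f (avg x.ofLp)
        - globalObj f (avg x.ofLp - α • (avg (gradStack f x + e).ofLp))
        + α * L ^ 2 / (2 * n) * ‖center n d x‖ ^ 2
        - α * inner ℝ (gradient (globalObj f) (avg x.ofLp)) (avg e.ofLp)
        + L * α ^ 2 * (‖avg (gradStack f x).ofLp‖ ^ 2 + ‖avg e.ofLp‖ ^ 2) := by
  have hn' : (0 : ℝ) < n := by exact_mod_cast hn
  have h1 := le_of_lipschitz_gradient
    (fun y => (hasGradientAt_globalObj h.differentiable y).differentiableAt)
    (h.lipschitz_globalObj hn) (avg x.ofLp) (-(α • avg (gradStack f x + e).ofLp))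
  rw [← sub_eq_add_neg, WithLp.ofLp_add, avg_add] at h1
  rw [WithLp.ofLp_add, avg_add]
  have h2 := h.norm_gradient_sub_avg_le hn x
  set g := gradient (globalObj f) (avg x.ofLp)
  set G := avg (gradStack f x).ofLp
  set b := avg e.ofLp
  rw [inner_neg_right, inner_smul_right, inner_add_right, norm_neg, norm_smul, mul_pow,
    Real.norm_eq_abs, sq_abs] at h1
  have h3 := norm_add_sq_le_two G b
  -- Polarisation of the inner product of `g` and `G`: it yields both `‖g‖²` and `‖G‖²` on the
  -- decreasing side, at the price of `‖g - G‖²`.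
  have h4 := norm_sub_sq_real g G
  have h5 : α * L ^ 2 / (2 * n) * ‖center n d x‖ ^ 2
      = α / 2 * (L ^ 2 * ‖center n d x‖ ^ 2 / n) := by field_simp
  have h6 : ‖g - G‖ ^ 2 ≤ L ^ 2 * ‖center n d x‖ ^ 2 / n := by
    rw [le_div_iff₀ hn']; linarith
  have h7 := mul_le_mul_of_nonneg_left h6 (by positivity : 0 ≤ α / 2)
  have h8 := mul_le_mul_of_nonneg_left h3 (by positivity : 0 ≤ L / 2 * α ^ 2)
  rw [h5]
  nlinarith

end Smooth

/-! ### Square integrable vectors and orthogonal noise. -/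

section SquareIntegrable

variable {Ω : Type*} {m₀ : MeasurableSpace Ω} {μ : Measure Ω}

theorem integrable_norm_sq {E : Type*} [NormedAddCommGroup E] {u : Ω → E}
    (hu : MemLp u 2 μ) : Integrable (fun ω => ‖u ω‖ ^ 2) μ :=
  (memLp_two_iff_integrable_sq_norm hu.1).1 hu

theorem integrable_real_inner {E : Type*} [NormedAddCommGroup E] [InnerProductSpace ℝ E]
    {u v : Ω → E} (hu : MemLp u 2 μ) (hv : MemLp v 2 μ) :
    Integrable (fun ω => inner ℝ (u ω) (v ω)) μ := by
  refine ((integrable_norm_sq hu).add (integrable_norm_sq hv)).mono'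
    (hu.1.inner hv.1) (Filter.Eventually.of_forall fun ω => ?_)
  refine (norm_inner_le_norm _ _).trans ?_
  simp only [Pi.add_apply]
  nlinarith [sq_nonneg (‖u ω‖ - ‖v ω‖), sq_nonneg ‖u ω‖, sq_nonneg ‖v ω‖]

theorem memLp_comp_lipschitz [IsFiniteMeasure μ] {E F : Type*} [NormedAddCommGroup E]
    [NormedAddCommGroup F] {g : E → F} {L : ℝ} (hg : ∀ x y, ‖g x - g y‖ ≤ L * ‖x - y‖) {u : Ω → E}
    (hu : MemLp u 2 μ) : MemLp (fun ω => g (u ω)) 2 μ := by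
  have hcont : Continuous g := (LipschitzWith.of_dist_le' (K := L) fun x y => by
    simpa only [dist_eq_norm] using hg x y).continuous
  have h0 : MemLp (fun _ : Ω => ‖g 0‖) 2 μ := memLp_const _
  have h1 : MemLp (fun ω => L * ‖u ω‖) 2 μ := hu.norm.const_mul L
  have hb : MemLp (fun ω => ‖g 0‖ + L * ‖u ω‖) 2 μ := h0.add h1
  refine hb.of_le (hcont.comp_aestronglyMeasurable hu.1) (Filter.Eventually.of_forall fun ω => ?_)
  refine le_trans ?_ (le_abs_self _)
  have h1 := hg (u ω) 0
  rw [sub_zero] at h1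
  have h2 := norm_add_le (g (u ω) - g 0) (g 0)
  rw [sub_add_cancel] at h2
  linarith

/-- Pythagoras' identity for orthogonal increments. -/
theorem integral_norm_sq_sum {E : Type*} [NormedAddCommGroup E] [InnerProductSpace ℝ E]
    {v : ℕ → Ω → E} (hv : ∀ j, MemLp (v j) 2 μ)
    (horth : ∀ i j, i < j → ∫ ω, inner ℝ (v j ω) (v i ω) ∂μ = 0) (N : ℕ) :
    ∫ ω, ‖∑ j ∈ Finset.range N, v j ω‖ ^ 2 ∂μ = ∑ j ∈ Finset.range N, ∫ ω, ‖v j ω‖ ^ 2 ∂μ := by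
  induction N with
  | zero => simp
  | succ N ih =>
    have hS : MemLp (fun ω => ∑ j ∈ Finset.range N, v j ω) 2 μ :=
      memLp_finsetSum _ fun j _ => hv j
    have h1 := integrable_norm_sq hS
    have h2 := integrable_norm_sq (hv N)
    have h3 := integrable_real_inner (hv N) hS
    have h4 : ∫ ω, inner ℝ (v N ω) (∑ j ∈ Finset.range N, v j ω) ∂μ = 0 := by
      simp only [inner_sum]
      rw [integral_finsetSum _ fun j _ => integrable_real_inner (hv N) (hv j)]
      exact Finset.sum_eq_zero fun j hj => horth j N (Finset.mem_range.1 hj)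
    rw [Finset.sum_range_succ, ← ih]
    have h5 : ∀ ω, ‖∑ j ∈ Finset.range (N + 1), v j ω‖ ^ 2
        = ‖∑ j ∈ Finset.range N, v j ω‖ ^ 2
          + 2 * inner ℝ (v N ω) (∑ j ∈ Finset.range N, v j ω) + ‖v N ω‖ ^ 2 := fun ω => by
      rw [Finset.sum_range_succ, norm_add_sq_real, real_inner_comm]
    simp only [h5]
    have h6 := integral_add (h1.add (h3.const_mul 2)) h2
    have h7 := integral_add h1 (h3.const_mul 2)
    simp only [Pi.add_apply] at h6 h7
    rw [h6, h7, integral_const_mul, h4]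
    ring

/-- `e k` is square integrable, known at time `k + 1`, and orthogonal to everything known at
time `k`. -/
structure IsNoise {E : Type*} [NormedAddCommGroup E] [InnerProductSpace ℝ E] [MeasurableSpace E]
    (μ : Measure Ω) (𝒢 : Filtration ℕ m₀) (e : ℕ → Ω → E) : Prop where
  memLp : ∀ k, MemLp (e k) 2 μ
  measurable : ∀ k, Measurable[𝒢 (k + 1)] (e k)
  orthogonal : ∀ k (Y : Ω → E), Measurable[𝒢 k] Y → MemLp Y 2 μ →
    ∫ ω, inner ℝ (e k ω) (Y ω) ∂μ = 0

theorem IsNoise.integral_sq_noiseOp_le {E : Type*} [NormedAddCommGroup E] [InnerProductSpace ℝ E]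
    [CompleteSpace E] [MeasurableSpace E] [BorelSpace E] {𝒢 : Filtration ℕ m₀}
    {e : ℕ → Ω → E} (he : IsNoise μ 𝒢 e) {A : ℕ → E →L[ℝ] E} {C : E →L[ℝ] E} {τ : ℕ}
    (hA : ∀ k v, ‖A k v‖ ≤ ‖v‖) (hC : ∀ v, ‖C v‖ ≤ ‖v‖)
    (h2 : ∀ j r, 2 * τ ≤ r → transition A j r = 0) {V : ℝ}
    (hV : ∀ k, ∫ ω, ‖e k ω‖ ^ 2 ∂μ ≤ V) (m : ℕ) :
    ∫ ω, ‖∑ j ∈ Finset.range m, noiseOp A m j (C (e j ω))‖ ^ 2 ∂μ ≤ 32 * (τ : ℝ) ^ 3 * V := by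
  have hmem : ∀ S : E →L[ℝ] E, ∀ j, MemLp (fun ω => S (e j ω)) 2 μ :=
    fun S j => S.comp_memLp' (he.memLp j)
  have hV0 : 0 ≤ V := (integral_nonneg fun ω => sq_nonneg _).trans (hV 0)
  rw [integral_norm_sq_sum (v := fun j ω => noiseOp A m j (C (e j ω)))
    (fun j => hmem ((noiseOp A m j).comp C) j)]
  · refine le_trans (Finset.sum_le_sum fun j _ => ?_)
      ((Finset.sum_mul _ _ _).symm.le.trans
        (mul_le_mul_of_nonneg_right (sum_sq_noise_weight_le m) hV0))
    split_ifs with hj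
    · calc ∫ ω, ‖noiseOp A m j (C (e j ω))‖ ^ 2 ∂μ
          ≤ ∫ ω, (2 * ((m - j : ℕ) : ℝ)) ^ 2 * ‖e j ω‖ ^ 2 ∂μ := by
            refine integral_mono (integrable_norm_sq (hmem ((noiseOp A m j).comp C) j))
              ((integrable_norm_sq (he.memLp j)).const_mul _) fun ω => ?_
            simp only
            rw [← mul_pow]
            refine pow_le_pow_left₀ (norm_nonneg _) ((norm_noiseOp_le hA m j _).trans ?_) 2
            gcongr
            exact hC _
        _ ≤ _ := by
            rw [integral_const_mul]
            exact mul_le_mul_of_nonneg_left (hV j) (sq_nonneg _)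
    · rw [noiseOp_eq_zero h2 (not_lt.1 hj)]
      simp
  · intro i j hij
    -- The adjoint moves the operator off the later noise, leaving `e j` against a vector already
    -- known at time `i + 1 ≤ j`.
    have h1 : ∀ ω, inner ℝ (noiseOp A m j (C (e j ω))) (noiseOp A m i (C (e i ω)))
        = inner ℝ (e j ω) ((ContinuousLinearMap.adjoint ((noiseOp A m j).comp C)).comp
            ((noiseOp A m i).comp C) (e i ω)) := fun ω => by
      rw [ContinuousLinearMap.comp_apply, ContinuousLinearMap.adjoint_inner_right]
      rfl
    simp only [h1]
    refine he.orthogonal j _ ?_ (hmem _ i)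
    exact (ContinuousLinearMap.continuous _).measurable.comp
      ((he.measurable i).mono (𝒢.mono hij) le_rfl)

end SquareIntegrable

/-! ### Step size and numerical constants. -/

section Arithmetic

theorem forty_eight_mul_sq_le {α L τ : ℝ} (hL : 0 < L) (hα : 0 < α) (hτ : 1 ≤ τ)
    (hstep : α ≤ 1 / (4 * √3 * τ ^ 2 * L)) : 48 * (α * L * τ ^ 2) ^ 2 ≤ 1 := by
  have h3 : √3 ^ 2 = 3 := Real.sq_sqrt (by norm_num)
  have h3' : 0 < √3 := Real.sqrt_pos.2 (by norm_num)
  rw [le_div_iff₀ (by positivity)] at hstep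
  have h1 := pow_le_one₀ (n := 2) (by positivity) hstep
  calc 48 * (α * L * τ ^ 2) ^ 2 = 16 * √3 ^ 2 * (α * L * τ ^ 2) ^ 2 := by rw [h3]; ring
    _ = (α * (4 * √3 * τ ^ 2 * L)) ^ 2 := by ring
    _ ≤ 1 := h1

/-- Combination of the bounds on the disagreement and on the decrease of the objective. -/
theorem stationarity_bound {α L τ n N D E Δ X S B V : ℝ} (hL : 0 < L) (hα : 0 < α)
    (hτ : 1 ≤ τ) (hn' : 0 < n) (hN : 0 ≤ N) (hV : 0 ≤ V) (hD0 : 0 ≤ D) (hE0 : 0 ≤ E)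
    (hΔ0 : 0 ≤ Δ) (hS0 : 0 ≤ S) (hp48 : 48 * (α * L * τ ^ 2) ^ 2 ≤ 1)
    (hdis : X ≤ α ^ 2 * n * B + 24 * (τ * D + α ^ 2 * τ ^ 3 * E)
      + 12 * α ^ 2 * (N * (32 * τ ^ 3 * (n * V))))
    (hgap : α / 2 * S ≤ Δ + α * L ^ 2 / (2 * n) * X + L * α ^ 2 * B) (hB : B ≤ S + N * V) :
    S ≤ 48 * (Δ / α + L ^ 2 * (τ * (n⁻¹ * D) + α ^ 2 * τ ^ 3 * (n⁻¹ * E)))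
      + 18 * (N * (V / τ)) := by
  have hτ0 : (0 : ℝ) < τ := by linarith
  set p := α * L * τ ^ 2 with hp
  have hp0 : 0 < p := by positivity
  -- From `48 p² ≤ 1`, since `36 ≤ 48`.
  have hp6 : 6 * p ≤ 1 := by nlinarith
  have hp4 : α ^ 2 * L ^ 2 * τ ^ 4 = p ^ 2 := by rw [hp]; ring
  set Q := N * (V / τ) with hQ
  have hQ0 : 0 ≤ Q := by positivity
  have hQτ : N * V = Q * τ := by rw [hQ]; field_simp
  set R := L ^ 2 * (τ * (n⁻¹ * D) + α ^ 2 * τ ^ 3 * (n⁻¹ * E)) with hR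
  have hR0 : 0 ≤ R := by positivity
  have e1 : S ≤ 2 * (Δ / α) + L ^ 2 / n * X + 2 * (L * α) * B := by
    have h1 := mul_le_mul_of_nonneg_left hgap (by positivity : 0 ≤ 2 / α)
    have h2 : 2 / α * (α / 2 * S) = S := by field_simp
    have h3 : 2 / α * (Δ + α * L ^ 2 / (2 * n) * X + L * α ^ 2 * B)
        = 2 * (Δ / α) + L ^ 2 / n * X + 2 * (L * α) * B := by field_simp
    linarith
  have e2 : L ^ 2 / n * X ≤ α ^ 2 * L ^ 2 * B + 24 * R
      + 384 * (α ^ 2 * L ^ 2 * τ ^ 4) * Q := by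
    refine (mul_le_mul_of_nonneg_left hdis (by positivity : 0 ≤ L ^ 2 / n)).trans (le_of_eq ?_)
    have : N * (32 * τ ^ 3 * (n * V)) = 32 * τ ^ 3 * n * (Q * τ) := by
      rw [← hQτ]; ring
    rw [this, hR]
    field_simp
    ring
  have hLα : L * α ≤ p ∧ L * α * τ ≤ p := by
    have h1 : 0 < L * α := by positivity
    rw [hp]
    constructor <;> nlinarith [mul_pos h1 hτ0, mul_nonneg h1.le (sub_nonneg.2 hτ)]
  have hsq : α ^ 2 * L ^ 2 ≤ p ^ 2 ∧ α ^ 2 * L ^ 2 * τ ≤ p ^ 2 := by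
    have h1 : 0 ≤ α ^ 2 * L ^ 2 := by positivity
    have h2 : p ^ 2 = α ^ 2 * L ^ 2 * τ ^ 4 := by rw [hp]; ring
    rw [h2]
    constructor
    · exact le_mul_of_one_le_right h1 (one_le_pow₀ hτ)
    · exact mul_le_mul_of_nonneg_left (le_self_pow₀ hτ (by norm_num)) h1
  have e3 : α ^ 2 * L ^ 2 * B ≤ 1 / 48 * S + 1 / 48 * Q := by
    refine (mul_le_mul_of_nonneg_left hB (by positivity)).trans ?_
    rw [hQτ, mul_add]
    have h1 := mul_le_mul_of_nonneg_right hsq.1 hS0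
    have h2 := mul_le_mul_of_nonneg_right hsq.2 hQ0
    have h3 := mul_le_mul_of_nonneg_right hp48 hS0
    have h4 := mul_le_mul_of_nonneg_right hp48 hQ0
    linarith
  have e4 : 2 * (L * α) * B ≤ 1 / 3 * S + 1 / 3 * Q := by
    refine (mul_le_mul_of_nonneg_left hB (by positivity)).trans ?_
    rw [hQτ, mul_add]
    have h1 := mul_le_mul_of_nonneg_right hLα.1 hS0
    have h2 := mul_le_mul_of_nonneg_right hLα.2 hQ0
    have h3 := mul_le_mul_of_nonneg_right hp6 hS0
    have h4 := mul_le_mul_of_nonneg_right hp6 hQ0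
    linarith
  have e5 : 384 * (α ^ 2 * L ^ 2 * τ ^ 4) * Q ≤ 8 * Q :=
    mul_le_mul_of_nonneg_right (by rw [hp4]; linarith) hQ0
  have hΔα : 0 ≤ Δ / α := by positivity
  -- Together `S ≤ 2 Δ / α + 24 R + (17 / 48) S + (8 + 17 / 48) Q`. Dividing by `31 / 48` gives
  -- coefficients below `48`, `48` and `18`.
  linarith

end Arithmetic

/-! ### Expected disagreement, expected descent and the summed rate. -/

section Rate

variable {n d : ℕ} {f : Fin n → Vec d → ℝ} {L : ℝ}

theorem continuous_avg : Continuous fun v : Stack n d => avg v.ofLp := by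
  unfold avg
  fun_prop

theorem norm_avg_le_norm (hn : 0 < n) (v : Stack n d) : ‖avg v.ofLp‖ ≤ ‖v‖ := by
  refine le_of_sq_le_sq ?_ (norm_nonneg _)
  refine le_trans ?_ (norm_avg_sq_le hn v)
  have : (1 : ℝ) ≤ n := by exact_mod_cast hn
  nlinarith [sq_nonneg ‖avg v.ofLp‖]

theorem SmoothBelow.lipschitz_gradStack (h : SmoothBelow f L) (hL : 0 < L) (x y : Stack n d) :
    ‖gradStack f x - gradStack f y‖ ≤ L * ‖x - y‖ := by
  refine le_of_sq_le_sq ?_ (by positivity)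
  rw [mul_pow]
  exact h.norm_gradStack_sub_le x y

variable {Ω : Type*} {m₀ : MeasurableSpace Ω} {μ : Measure Ω}

theorem memLp_avg (hn : 0 < n) {x : Ω → Stack n d} (hx : MemLp x 2 μ) :
    MemLp (fun ω => avg (x ω).ofLp) 2 μ :=
  hx.of_le (continuous_avg.comp_aestronglyMeasurable hx.1)
    (Filter.Eventually.of_forall fun _ => norm_avg_le_norm hn _)

/-- Jensen over the agents, without the gain `1 / n` from orthogonality between agents. This
suffices because this noise is multiplied by `L α` or `α² L²`, and `L α τ` is bounded by `α L τ²`.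
-/
theorem integral_sq_avg_le (hn : 0 < n) {e : Ω → Stack n d} (he : MemLp e 2 μ) {σ : ℝ}
    (hV : ∫ ω, ‖e ω‖ ^ 2 ∂μ ≤ n * σ ^ 2) : ∫ ω, ‖avg (e ω).ofLp‖ ^ 2 ∂μ ≤ σ ^ 2 := by
  have hn' : (0 : ℝ) < n := by exact_mod_cast hn
  refine le_of_mul_le_mul_left (le_trans ?_ hV) hn'
  rw [← integral_const_mul]
  exact integral_mono ((integrable_norm_sq (memLp_avg hn he)).const_mul _)
    (integrable_norm_sq he) fun ω => norm_avg_sq_le hn _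

variable [IsProbabilityMeasure μ]

/-- The lower bound on `f` and the quadratic upper bound at `0` dominate `f` by a function of `‖X‖`.
-/
theorem SmoothBelow.integrable_globalObj (h : SmoothBelow f L) (hn : 0 < n)
    {X : Ω → Vec d} (hX : MemLp X 2 μ) : Integrable (fun ω => globalObj f (X ω)) μ := by
  have hdiff : Differentiable ℝ (globalObj f) :=
    fun y => (hasGradientAt_globalObj h.differentiable y).differentiableAt
  obtain ⟨b, hb⟩ := h.bddBelow
  have hint : Integrable (fun ω => |b| + (|globalObj f 0| + (‖gradient (globalObj f) 0‖ * ‖X ω‖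
      + |L / 2| * ‖X ω‖ ^ 2))) μ :=
    (integrable_const _).add ((integrable_const _).add
      (((hX.integrable one_le_two).norm.const_mul _).add
        ((integrable_norm_sq hX).const_mul _)))
  refine hint.mono' (hdiff.continuous.comp_aestronglyMeasurable hX.1)
    (Filter.Eventually.of_forall fun ω => ?_)
  have h1 : b ≤ globalObj f (X ω) := hb ⟨_, rfl⟩
  have h2 := le_of_lipschitz_gradient hdiff (h.lipschitz_globalObj hn) 0 (X ω)
  rw [zero_add] at h2
  have h3 := real_inner_le_norm (gradient (globalObj f) 0) (X ω)
  have h4 := mul_le_mul_of_nonneg_right (le_abs_self (L / 2)) (sq_nonneg ‖X ω‖)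
  have h5 := neg_abs_le b
  have h6 := le_abs_self (globalObj f 0)
  have h7 : 0 ≤ ‖gradient (globalObj f) 0‖ * ‖X ω‖ := by positivity
  have h8 : 0 ≤ |L / 2| * ‖X ω‖ ^ 2 := by positivity
  have h9 := abs_nonneg (globalObj f 0)
  have h10 := abs_nonneg b
  rw [Real.norm_eq_abs, abs_le]
  constructor <;> linarith

/-- Expected accumulated disagreement of gradient tracking. -/
theorem sum_integral_sq_center_le {τ : ℕ} {W : ℕ → Matrix (Fin n) (Fin n) ℝ} {α σ : ℝ}
    {x g e : ℕ → Ω → Stack n d} {𝒢 : Filtration ℕ m₀} (hf : SmoothBelow f L) (hn : 0 < n)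
    (hL : 0 < L) (hW : FiniteTimeConsensus τ W)
    (hstep : 48 * (α ^ 2 * L ^ 2 * (τ : ℝ) ^ 4) ≤ 1)
    (htrack : ∀ ω, IsTracking τ W α (fun k => x k ω) (fun k => g k ω)
      fun k => gradStack f (x k ω) + e k ω)
    (hx : ∀ k, MemLp (x k) 2 μ) (he : IsNoise μ 𝒢 e)
    (hV : ∀ k, ∫ ω, ‖e k ω‖ ^ 2 ∂μ ≤ n * σ ^ 2) (N : ℕ) :
    ∑ k ∈ Finset.range N, ∫ ω, ‖center n d (x k ω)‖ ^ 2 ∂μ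
      ≤ α ^ 2 * n * ∑ k ∈ Finset.range N,
          (∫ ω, ‖avg (gradStack f (x k ω)).ofLp‖ ^ 2 ∂μ + σ ^ 2)
        + 24 * (τ * ∫ ω, ‖center n d (x 0 ω)‖ ^ 2 ∂μ
          + α ^ 2 * (τ : ℝ) ^ 3 * ∫ ω, ‖center n d (gradStack f (x 0 ω))‖ ^ 2 ∂μ)
        + 12 * α ^ 2 * (N * (32 * (τ : ℝ) ^ 3 * (n * σ ^ 2))) := by
  set A := disagreementOp d τ W with hA
  have hG : ∀ k, MemLp (fun ω => gradStack f (x k ω)) 2 μ :=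
    fun k => memLp_comp_lipschitz (hf.lipschitz_gradStack hL) (hx k)
  have hc : ∀ {u : Ω → Stack n d}, MemLp u 2 μ → MemLp (fun ω => center n d (u ω)) 2 μ :=
    fun hu => (center n d).comp_memLp' hu
  have hcx : ∀ k, Integrable (fun ω => ‖center n d (x k ω)‖ ^ 2) μ :=
    fun k => integrable_norm_sq (hc (hx k))
  have hcG : Integrable (fun ω => ‖center n d (gradStack f (x 0 ω))‖ ^ 2) μ :=
    integrable_norm_sq (hc (hG 0))
  have haG : ∀ k, Integrable (fun ω => ‖avg (gradStack f (x k ω)).ofLp‖ ^ 2) μ :=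
    fun k => integrable_norm_sq (memLp_avg hn (hG k))
  have hae : ∀ k, Integrable (fun ω => ‖avg (e k ω).ofLp‖ ^ 2) μ :=
    fun k => integrable_norm_sq (memLp_avg hn (he.memLp k))
  have hN : ∀ m, Integrable (fun ω =>
      ‖∑ j ∈ Finset.range m, noiseOp A m j (center n d (e j ω))‖ ^ 2) μ :=
    fun m => integrable_norm_sq (memLp_finsetSum _ fun j _ =>
      ((noiseOp A m j).comp (center n d)).comp_memLp' (he.memLp j))
  have hpt : ∀ ω, ∑ k ∈ Finset.range N, ‖center n d (x k ω)‖ ^ 2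
      ≤ α ^ 2 * n * ∑ k ∈ Finset.range N,
          (‖avg (gradStack f (x k ω)).ofLp‖ ^ 2 + ‖avg (e k ω).ofLp‖ ^ 2)
        + 24 * (τ * ‖center n d (x 0 ω)‖ ^ 2
          + α ^ 2 * (τ : ℝ) ^ 3 * ‖center n d (gradStack f (x 0 ω))‖ ^ 2)
        + 12 * α ^ 2 * ∑ m ∈ Finset.range N,
          ‖∑ j ∈ Finset.range m, noiseOp A m j (center n d (e j ω))‖ ^ 2 := by
    intro ω
    have h1 := (htrack ω).sum_sq_center_le (a := fun k => gradStack f (x k ω)) hn hW hstep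
      (fun k => hf.norm_gradStack_sub_le _ _) N
    simp only [add_sub_cancel_left, WithLp.ofLp_add, avg_add] at h1
    refine h1.trans ?_
    gcongr ?_ + _ + _
    rw [Finset.mul_sum, Finset.mul_sum]
    refine Finset.sum_le_sum fun k _ => ?_
    have h2 := norm_add_sq_le_two (avg (gradStack f (x k ω)).ofLp) (avg (e k ω).ofLp)
    have h3 := mul_le_mul_of_nonneg_left h2 (by positivity : 0 ≤ α ^ 2 / 2 * n)
    linarith
  have hI1 := integrable_finsetSum (Finset.range N) fun k _ => (haG k).add (hae k)
  have hI2 := integrable_finsetSum (Finset.range N) fun m _ => hN m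
  have hI3 := ((hcx 0).const_mul (τ : ℝ)).add (hcG.const_mul (α ^ 2 * (τ : ℝ) ^ 3))
  have hmono := integral_mono (integrable_finsetSum (Finset.range N) fun k _ => hcx k)
    (((hI1.const_mul (α ^ 2 * n)).add (hI3.const_mul 24)).add (hI2.const_mul (12 * α ^ 2))) hpt
  rw [integral_finsetSum _ fun k _ => hcx k, integral_add' ((hI1.const_mul _).add
    (hI3.const_mul _)) (hI2.const_mul _), integral_add' (hI1.const_mul _) (hI3.const_mul _),
    integral_const_mul, integral_const_mul, integral_const_mul,
    integral_finsetSum _ fun k _ => (haG k).add (hae k), integral_finsetSum _ fun m _ => hN m,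
    integral_add' ((hcx 0).const_mul _) (hcG.const_mul _), integral_const_mul,
    integral_const_mul] at hmono
  refine hmono.trans ?_
  gcongr ?_ + _ + 12 * α ^ 2 * ?_
  · refine mul_le_mul_of_nonneg_left (Finset.sum_le_sum fun k _ => ?_) (by positivity)
    rw [integral_add' (haG k) (hae k)]
    gcongr
    exact integral_sq_avg_le hn (he.memLp k) (hV k)
  · refine (Finset.sum_le_sum fun m _ => he.integral_sq_noiseOp_le
      (fun k v => norm_mixL_sub_avgMatrix_le hn (hW.mod_mem k) v) (norm_center_le hn)
      (transition_eq_zero hW.one_le (hW.transition_window hn)) hV m).trans ?_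
    simp

/-- Expected accumulated decrease of the objective. -/
theorem sum_stationarity_le_gap {τ : ℕ} {W : ℕ → Matrix (Fin n) (Fin n) ℝ} {α σ : ℝ}
    {x g e : ℕ → Ω → Stack n d} {𝒢 : Filtration ℕ m₀} (hf : SmoothBelow f L) (hn : 0 < n)
    (hL : 0 < L) (hα : 0 < α) (hW : FiniteTimeConsensus τ W)
    (htrack : ∀ ω, IsTracking τ W α (fun k => x k ω) (fun k => g k ω)
      fun k => gradStack f (x k ω) + e k ω)
    (hx : ∀ k, MemLp (x k) 2 μ) (hxm : ∀ k, Measurable[𝒢 k] (x k)) (he : IsNoise μ 𝒢 e)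
    (hV : ∀ k, ∫ ω, ‖e k ω‖ ^ 2 ∂μ ≤ n * σ ^ 2) (N : ℕ) :
    α / 2 * ∑ k ∈ Finset.range N, (∫ ω, ‖avg (gradStack f (x k ω)).ofLp‖ ^ 2 ∂μ
        + ∫ ω, ‖gradient (globalObj f) (avg (x k ω).ofLp)‖ ^ 2 ∂μ)
      ≤ (∫ ω, globalObj f (avg (x 0 ω).ofLp) ∂μ - ⨅ y, globalObj f y)
        + α * L ^ 2 / (2 * n) * ∑ k ∈ Finset.range N, ∫ ω, ‖center n d (x k ω)‖ ^ 2 ∂μ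
        + L * α ^ 2 * ∑ k ∈ Finset.range N,
          (∫ ω, ‖avg (gradStack f (x k ω)).ofLp‖ ^ 2 ∂μ + σ ^ 2) := by
  have hn' : (0 : ℝ) < n := by exact_mod_cast hn
  have hG : ∀ k, MemLp (fun ω => gradStack f (x k ω)) 2 μ :=
    fun k => memLp_comp_lipschitz (hf.lipschitz_gradStack hL) (hx k)
  have hcx : ∀ k, Integrable (fun ω => ‖center n d (x k ω)‖ ^ 2) μ :=
    fun k => integrable_norm_sq ((center n d).comp_memLp' (hx k))
  have haG : ∀ k, Integrable (fun ω => ‖avg (gradStack f (x k ω)).ofLp‖ ^ 2) μ :=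
    fun k => integrable_norm_sq (memLp_avg hn (hG k))
  have hae : ∀ k, Integrable (fun ω => ‖avg (e k ω).ofLp‖ ^ 2) μ :=
    fun k => integrable_norm_sq (memLp_avg hn (he.memLp k))
  have hgm : ∀ k, MemLp (fun ω => gradient (globalObj f) (avg (x k ω).ofLp)) 2 μ :=
    fun k => memLp_comp_lipschitz (hf.lipschitz_globalObj hn) (memLp_avg hn (hx k))
  have hg : ∀ k, Integrable (fun ω => ‖gradient (globalObj f) (avg (x k ω).ofLp)‖ ^ 2) μ :=
    fun k => integrable_norm_sq (hgm k)
  have hfx : ∀ k, Integrable (fun ω => globalObj f (avg (x k ω).ofLp)) μ :=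
    fun k => hf.integrable_globalObj hn (memLp_avg hn (hx k))
  have hinner : ∀ k, Integrable (fun ω =>
      inner ℝ (gradient (globalObj f) (avg (x k ω).ofLp)) (avg (e k ω).ofLp)) μ :=
    fun k => integrable_real_inner (hgm k) (memLp_avg hn (he.memLp k))
  have hzero : ∀ k, ∫ ω, inner ℝ (gradient (globalObj f) (avg (x k ω).ofLp)) (avg (e k ω).ofLp) ∂μ
      = 0 := by
    intro k
    -- The diagonal embedding, `n` times the adjoint of `avg`: it turns a product with the averaged
    -- noise into one with the stacked noise, where `IsNoise.orthogonal` applies.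
    set c : Vec d →L[ℝ] Stack n d :=
      ((PiLp.continuousLinearEquiv 2 ℝ fun _ : Fin n => Vec d).symm :
        (Fin n → Vec d) →L[ℝ] _).comp (ContinuousLinearMap.pi fun _ =>
          ContinuousLinearMap.id ℝ (Vec d)) with hc
    have hcont : Continuous (gradient (globalObj f)) :=
      (LipschitzWith.of_dist_le' (K := L) fun x y => by
        simpa only [dist_eq_norm] using hf.lipschitz_globalObj hn x y).continuous
    have h1 := he.orthogonal k (fun ω => c (gradient (globalObj f) (avg (x k ω).ofLp)))
      ((c.continuous.comp (hcont.comp continuous_avg)).measurable.comp (hxm k))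
      (c.comp_memLp' (hgm k))
    have h2 : ∀ ω, inner ℝ (gradient (globalObj f) (avg (x k ω).ofLp)) (avg (e k ω).ofLp)
        = (n : ℝ)⁻¹ * inner ℝ (e k ω) (c (gradient (globalObj f) (avg (x k ω).ofLp))) := fun ω => by
      rw [show avg (e k ω).ofLp = (n : ℝ)⁻¹ • ∑ i, (e k ω).ofLp i from rfl, inner_smul_right, inner_sum, PiLp.inner_apply]
      congr 1
      exact Finset.sum_congr rfl fun i _ => by rw [real_inner_comm]; simp [hc]
    simp only [h2]
    rw [integral_const_mul, h1, mul_zero]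
  have hstep : ∀ k, α / 2 * (∫ ω, ‖avg (gradStack f (x k ω)).ofLp‖ ^ 2 ∂μ
        + ∫ ω, ‖gradient (globalObj f) (avg (x k ω).ofLp)‖ ^ 2 ∂μ)
      ≤ (∫ ω, globalObj f (avg (x k ω).ofLp) ∂μ - ∫ ω, globalObj f (avg (x (k + 1) ω).ofLp) ∂μ)
        + α * L ^ 2 / (2 * n) * ∫ ω, ‖center n d (x k ω)‖ ^ 2 ∂μ
        + L * α ^ 2 * (∫ ω, ‖avg (gradStack f (x k ω)).ofLp‖ ^ 2 ∂μ + σ ^ 2) := by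
    intro k
    have hpt : ∀ ω, α / 2 * (‖avg (gradStack f (x k ω)).ofLp‖ ^ 2
          + ‖gradient (globalObj f) (avg (x k ω).ofLp)‖ ^ 2)
        ≤ globalObj f (avg (x k ω).ofLp) - globalObj f (avg (x (k + 1) ω).ofLp)
          + α * L ^ 2 / (2 * n) * ‖center n d (x k ω)‖ ^ 2
          - α * inner ℝ (gradient (globalObj f) (avg (x k ω).ofLp)) (avg (e k ω).ofLp)
          + L * α ^ 2 * (‖avg (gradStack f (x k ω)).ofLp‖ ^ 2 + ‖avg (e k ω).ofLp‖ ^ 2) := by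
      intro ω
      have h1 := hf.descent hn hL hα (x k ω) (e k ω)
      rwa [← (htrack ω).avg_x hW k] at h1
    have hmono := integral_mono (((haG k).add (hg k)).const_mul (α / 2))
      (((((hfx k).sub (hfx (k + 1))).add ((hcx k).const_mul (α * L ^ 2 / (2 * n)))).sub
        ((hinner k).const_mul α)).add (((haG k).add (hae k)).const_mul (L * α ^ 2))) hpt
    rw [integral_const_mul, integral_add' (haG k) (hg k),
      integral_add' ((((hfx k).sub (hfx (k + 1))).add ((hcx k).const_mul _)).sub
        ((hinner k).const_mul α)) (((haG k).add (hae k)).const_mul _),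
      integral_sub' (((hfx k).sub (hfx (k + 1))).add ((hcx k).const_mul _))
        ((hinner k).const_mul α),
      integral_add' ((hfx k).sub (hfx (k + 1))) ((hcx k).const_mul _),
      integral_sub' (hfx k) (hfx (k + 1)), integral_const_mul, integral_const_mul,
      integral_const_mul, integral_add' (haG k) (hae k), hzero k, mul_zero, sub_zero] at hmono
    refine hmono.trans ?_
    gcongr
    exact integral_sq_avg_le hn (he.memLp k) (hV k)
  have hinf : ⨅ y, globalObj f y ≤ ∫ ω, globalObj f (avg (x N ω).ofLp) ∂μ := by
    have h1 := integral_mono (μ := μ) (integrable_const (⨅ y, globalObj f y)) (hfx N)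
      fun ω => ciInf_le hf.bddBelow (avg (x N ω).ofLp)
    simpa using h1
  have htel := Finset.sum_range_sub' (fun k => ∫ ω, globalObj f (avg (x k ω).ofLp) ∂μ) N
  have hsum := Finset.sum_le_sum fun k (_ : k ∈ Finset.range N) => hstep k
  rw [← Finset.mul_sum, Finset.sum_add_distrib (f := fun k => _ + _ * _),
    Finset.sum_add_distrib (f := fun k => _ - _), htel, ← Finset.mul_sum, ← Finset.mul_sum] at hsum
  refine hsum.trans ?_
  gcongr

theorem sum_stationarity_le {τ : ℕ} {W : ℕ → Matrix (Fin n) (Fin n) ℝ} {α σ : ℝ}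
    {x g e : ℕ → Ω → Stack n d} {𝒢 : Filtration ℕ m₀} (hf : SmoothBelow f L) (hn : 0 < n)
    (hL : 0 < L) (hα : 0 < α) (hW : FiniteTimeConsensus τ W)
    (hstep : α ≤ 1 / (4 * √3 * (τ : ℝ) ^ 2 * L))
    (htrack : ∀ ω, IsTracking τ W α (fun k => x k ω) (fun k => g k ω)
      fun k => gradStack f (x k ω) + e k ω)
    (hx : ∀ k, MemLp (x k) 2 μ) (hxm : ∀ k, Measurable[𝒢 k] (x k)) (he : IsNoise μ 𝒢 e)
    (hV : ∀ k, ∫ ω, ‖e k ω‖ ^ 2 ∂μ ≤ n * σ ^ 2) (N : ℕ) :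
    ∑ k ∈ Finset.range N, (∫ ω, ‖avg (gradStack f (x k ω)).ofLp‖ ^ 2 ∂μ
        + ∫ ω, ‖gradient (globalObj f) (avg (x k ω).ofLp)‖ ^ 2 ∂μ)
      ≤ 48 * ((∫ ω, globalObj f (avg (x 0 ω).ofLp) ∂μ - ⨅ y, globalObj f y) / α
          + L ^ 2 * (τ * ((n : ℝ)⁻¹ * ∫ ω, ‖center n d (x 0 ω)‖ ^ 2 ∂μ)
          + α ^ 2 * (τ : ℝ) ^ 3
            * ((n : ℝ)⁻¹ * ∫ ω, ‖center n d (gradStack f (x 0 ω))‖ ^ 2 ∂μ)))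
        + 18 * (N * (σ ^ 2 / τ)) := by
  have hn' : (0 : ℝ) < n := by exact_mod_cast hn
  have hτ : (1 : ℝ) ≤ τ := by exact_mod_cast hW.one_le
  have hp48 := forty_eight_mul_sq_le hL hα hτ hstep
  have hp48' : 48 * (α ^ 2 * L ^ 2 * (τ : ℝ) ^ 4) ≤ 1 := by
    calc 48 * (α ^ 2 * L ^ 2 * (τ : ℝ) ^ 4) = 48 * (α * L * (τ : ℝ) ^ 2) ^ 2 := by ring
      _ ≤ 1 := hp48
  have hdis := sum_integral_sq_center_le hf hn hL hW hp48' htrack hx he hV N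
  have hgap := sum_stationarity_le_gap hf hn hL hα hW htrack hx hxm he hV N
  have hB : ∑ k ∈ Finset.range N, (∫ ω, ‖avg (gradStack f (x k ω)).ofLp‖ ^ 2 ∂μ + σ ^ 2)
      ≤ (∑ k ∈ Finset.range N, (∫ ω, ‖avg (gradStack f (x k ω)).ofLp‖ ^ 2 ∂μ
        + ∫ ω, ‖gradient (globalObj f) (avg (x k ω).ofLp)‖ ^ 2 ∂μ)) + N * σ ^ 2 := by
    rw [Finset.sum_add_distrib, Finset.sum_const, Finset.card_range, nsmul_eq_mul]
    gcongr
    refine le_add_of_nonneg_right ?_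
    exact integral_nonneg fun ω => sq_nonneg _
  have hΔ0 : 0 ≤ ∫ ω, globalObj f (avg (x 0 ω).ofLp) ∂μ - ⨅ y, globalObj f y := by
    have h1 := integral_mono (μ := μ) (integrable_const (⨅ y, globalObj f y))
      (hf.integrable_globalObj hn (memLp_avg hn (hx 0)))
      fun ω => ciInf_le hf.bddBelow (avg (x 0 ω).ofLp)
    simp only [integral_const, probReal_univ, one_smul] at h1
    exact sub_nonneg.2 h1
  exact stationarity_bound hL hα hτ hn' N.cast_nonneg (sq_nonneg σ)
    (integral_nonneg fun ω => sq_nonneg _) (integral_nonneg fun ω => sq_nonneg _) hΔ0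
    (Finset.sum_nonneg fun k _ => add_nonneg (integral_nonneg fun ω => sq_nonneg _)
      (integral_nonneg fun ω => sq_nonneg _)) hp48 hdis hgap hB

end Rate

/-! ### From conditional unbiasedness to orthogonality against the whole past. -/

section Independence

variable {Ω : Type*} {m₀ : MeasurableSpace Ω} {μ : Measure Ω} [IsProbabilityMeasure μ]

/-- Both hypotheses together make the joint law a triple product, and the product of measures is
associative. -/
theorem indepFun_prodMk_left {α β γ : Type*} [MeasurableSpace α] [MeasurableSpace β]
    [MeasurableSpace γ] {X : Ω → α} {Y : Ω → β} {Z : Ω → γ} (hX : Measurable X)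
    (hY : Measurable Y) (hZ : Measurable Z) (h : IndepFun X (fun ω => (Y ω, Z ω)) μ)
    (h' : IndepFun Y Z μ) : IndepFun (fun ω => (X ω, Y ω)) Z μ := by
  have hXY : IndepFun X Y μ := h.comp measurable_id measurable_fst
  rw [indepFun_iff_map_prod_eq_prod_map_map hX.aemeasurable hY.aemeasurable] at hXY
  rw [indepFun_iff_map_prod_eq_prod_map_map hY.aemeasurable hZ.aemeasurable] at h'
  rw [indepFun_iff_map_prod_eq_prod_map_map hX.aemeasurable (hY.prodMk hZ).aemeasurable, h'] at h
  rw [indepFun_iff_map_prod_eq_prod_map_map (hX.prodMk hY).aemeasurable hZ.aemeasurable, hXY]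
  have := Measure.isProbabilityMeasure_map (μ := μ) hX.aemeasurable
  have := Measure.isProbabilityMeasure_map (μ := μ) hY.aemeasurable
  have := Measure.isProbabilityMeasure_map (μ := μ) hZ.aemeasurable
  apply MeasurableEquiv.prodAssoc.map_measurableEquiv_injective
  rw [Measure.prodAssoc_prod, ← h,
    Measure.map_map MeasurableEquiv.prodAssoc.measurable ((hX.prodMk hY).prodMk hZ)]
  rfl

/-- If `φ (X, V)` has conditional mean zero given `X` and `V` is independent of `(X, Y)`, then
`φ (X, V)` is orthogonal to `Y`. -/
theorem integral_inner_eq_zero_of_indepFun {α β E : Type*} [MeasurableSpace α]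
    [MeasurableSpace β] [NormedAddCommGroup E] [InnerProductSpace ℝ E] [CompleteSpace E]
    [SecondCountableTopology E] [MeasurableSpace E] [BorelSpace E] {X : Ω → α} {Y : Ω → E}
    {V : Ω → β} {φ : α × β → E} (hX : Measurable X) (hY : Measurable Y) (hV : Measurable V)
    (hφ : Measurable φ) (hind : IndepFun (fun ω => (X ω, Y ω)) V μ)
    (hint : Integrable (fun ω => φ (X ω, V ω)) μ)
    (hinner : Integrable (fun ω => inner ℝ (φ (X ω, V ω)) (Y ω)) μ)
    (hzero : ∀ s, MeasurableSet s → ∫ ω in X ⁻¹' s, φ (X ω, V ω) ∂μ = 0) :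
    ∫ ω, inner ℝ (φ (X ω, V ω)) (Y ω) ∂μ = 0 := by
  have := Measure.isProbabilityMeasure_map (μ := μ) hX.aemeasurable
  have := Measure.isProbabilityMeasure_map (μ := μ) hV.aemeasurable
  have := Measure.isProbabilityMeasure_map (μ := μ) (hX.prodMk hY).aemeasurable
  have hXV : IndepFun X V μ := hind.comp measurable_fst measurable_id
  have hmapX := hXV.map_prod_eq_prod_map_map hX.aemeasurable hV.aemeasurable
  have hmap := hind.map_prod_eq_prod_map_map (hX.prodMk hY).aemeasurable hV.aemeasurable
  have hφX : Integrable φ ((μ.map X).prod (μ.map V)) := by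
    rw [← hmapX, integrable_map_measure hφ.aestronglyMeasurable (hX.prodMk hV).aemeasurable]
    exact hint
  -- By independence, the conditional mean given `X = a` is obtained by integrating out `V` with `a`
  -- frozen. Its integral over every measurable set is zero, so it vanishes for almost every `a`;
  -- adjoining `Y`, also independent of `V`, changes nothing.
  have hmean : (fun a => ∫ z, φ (a, z) ∂(μ.map V)) =ᵐ[μ.map X] 0 := by
    refine hφX.integral_prod_left.ae_eq_zero_of_forall_setIntegral_eq_zero fun s hs _ => ?_
    have h1 := setIntegral_prod (μ := μ.map X) (ν := μ.map V) φ (s := s) (t := Set.univ)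
      hφX.integrableOn
    rw [Measure.restrict_univ] at h1
    rw [← h1, ← hmapX, setIntegral_map (hs.prod MeasurableSet.univ) hφ.aestronglyMeasurable
      (hX.prodMk hV).aemeasurable, ← hzero s hs]
    congr 2
    ext ω
    simp
  have hψm : Measurable fun q : (α × E) × β => inner ℝ (φ (q.1.1, q.2)) q.1.2 :=
    (hφ.comp ((measurable_fst.comp measurable_fst).prodMk measurable_snd)).inner
      (measurable_snd.comp measurable_fst)
  have hψ : Integrable (fun q : (α × E) × β => inner ℝ (φ (q.1.1, q.2)) q.1.2)
      ((μ.map fun ω => (X ω, Y ω)).prod (μ.map V)) := by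
    rw [← hmap, integrable_map_measure hψm.aestronglyMeasurable
      ((hX.prodMk hY).prodMk hV).aemeasurable]
    exact hinner
  have hfst : Measure.map Prod.fst (μ.map fun ω => (X ω, Y ω)) = μ.map X :=
    Measure.map_map measurable_fst (hX.prodMk hY)
  have h0 : ∀ᵐ q ∂(μ.map fun ω => (X ω, Y ω)), ∫ z, φ (q.1, z) ∂(μ.map V) = 0 := by
    rw [← hfst] at hmean
    exact ae_of_ae_map measurable_fst.aemeasurable hmean
  have h1 : ∀ᵐ q ∂(μ.map fun ω => (X ω, Y ω)), Integrable (fun z => φ (q.1, z)) (μ.map V) := by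
    have := hφX.prod_right_ae
    rw [← hfst] at this
    exact ae_of_ae_map measurable_fst.aemeasurable this
  calc ∫ ω, inner ℝ (φ (X ω, V ω)) (Y ω) ∂μ
      = ∫ q, inner ℝ (φ (q.1.1, q.2)) q.1.2 ∂((μ.map fun ω => (X ω, Y ω)).prod (μ.map V)) := by
        rw [← hmap, integral_map ((hX.prodMk hY).prodMk hV).aemeasurable
          hψm.aestronglyMeasurable]
    _ = ∫ q, ∫ z, inner ℝ (φ (q.1, z)) q.2 ∂(μ.map V) ∂(μ.map fun ω => (X ω, Y ω)) :=
        integral_prod _ hψ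
    _ = 0 := by
        refine integral_eq_zero_of_ae ?_
        filter_upwards [h0, h1] with q hq0 hq1
        simp only [real_inner_comm q.2, Pi.zero_apply]
        rw [integral_inner hq1, hq0, inner_zero_right]

end Independence

/-! ### Measurability of the iterates and the filtration of past samples. -/

section Samples

variable {n d : ℕ} {Ξ : Fin n → Type*}

theorem isTracking_state (F : ∀ i, Vec d → Ξ i → ℝ) (τ : ℕ) (W : ℕ → Matrix (Fin n) (Fin n) ℝ)
    (α : ℝ) (x₀ : Fin n → Vec d) (z : ℕ → ∀ i, Ξ i) :
    IsTracking τ W α (fun k => WithLp.toLp 2 (state F τ W α x₀ z k).1)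
      (fun k => WithLp.toLp 2 (state F τ W α x₀ z k).2)
      (fun k => WithLp.toLp 2 fun i => stochGrad F i ((state F τ W α x₀ z k).1 i) (z k i)) where
  x_succ k := by
    rw [← WithLp.toLp_smul, ← WithLp.toLp_sub, mixL_toLp]
    rfl
  g_zero := rfl
  g_succ k := by
    rw [mixL_toLp, ← WithLp.toLp_sub, ← WithLp.toLp_add]
    congr 1
    funext i
    exact add_sub_assoc _ _ _

theorem measurable_mix {Ω : Type*} [MeasurableSpace Ω] (W : Matrix (Fin n) (Fin n) ℝ)
    {v : Ω → Fin n → Vec d} (hv : Measurable v) : Measurable fun ω => mix W (v ω) := by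
  unfold mix
  fun_prop

variable [∀ i, MeasurableSpace (Ξ i)]

/-- The parameters at time `k` involve only samples before `k`, while the tracker also uses sample
`k`; the noise at time `k` is therefore fresh relative to the parameters. -/
theorem measurable_state {Ω : Type*} [MeasurableSpace Ω] {F : ∀ i, Vec d → Ξ i → ℝ} {τ : ℕ}
    {W : ℕ → Matrix (Fin n) (Fin n) ℝ} {α : ℝ} {x₀ : Ω → Fin n → Vec d}
    {ξ : ℕ → ∀ i, Ω → Ξ i}
    (hF : ∀ i, Measurable fun p : Vec d × Ξ i => stochGrad F i p.1 p.2) (hx₀ : Measurable x₀)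
    (k : ℕ) (hξ : ∀ l < k, ∀ i, Measurable (ξ l i)) :
    Measurable (fun ω => (state F τ W α (x₀ ω) (fun l i => ξ l i ω) k).1) ∧
    ((∀ i, Measurable (ξ k i)) →
      Measurable (fun ω => (state F τ W α (x₀ ω) (fun l i => ξ l i ω) k).2)) := by
  have hs : ∀ (v : Ω → Fin n → Vec d) (l : ℕ), Measurable v → (∀ i, Measurable (ξ l i)) →
      ∀ i, Measurable fun ω => stochGrad F i (v ω i) (ξ l i ω) := fun v l hv hl i =>
    (hF i).comp (((measurable_pi_apply i).comp hv).prodMk (hl i))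
  induction k with
  | zero => exact ⟨hx₀, fun h0 => measurable_pi_lambda _ (hs _ 0 hx₀ h0)⟩
  | succ k ih =>
    obtain ⟨hx, hg⟩ := ih fun l hl => hξ l (hl.trans k.lt_succ_self)
    have hk := hξ k k.lt_succ_self
    have hg := hg hk
    have hx' : Measurable fun ω => (state F τ W α (x₀ ω) (fun l i => ξ l i ω) (k + 1)).1 :=
      measurable_mix (W (k % τ)) (measurable_pi_lambda _ fun i =>
        ((measurable_pi_apply i).comp hx).sub (((measurable_pi_apply i).comp hg).const_smul α))
    refine ⟨hx', fun hk' => measurable_pi_lambda _ fun i => ?_⟩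
    exact (((measurable_pi_apply i).comp (measurable_mix (W (k % τ)) hg)).add
      (hs _ (k + 1) hx' hk' i)).sub (hs _ k hx hk i)

theorem measurable_toLp_pi {Ω : Type*} {m : MeasurableSpace Ω} {v : Fin n → Ω → Vec d}
    (hv : ∀ i, Measurable (v i)) :
    Measurable fun ω => (WithLp.toLp 2 fun i => v i ω : Stack n d) :=
  (WithLp.measurable_toLp 2 _).comp (measurable_pi_lambda _ hv)

/-- The initial points and the samples before time `k`. -/
def pastData {Ω : Type*} (x₀ : Fin n → Ω → Vec d) (ξ : ℕ → ∀ i, Ω → Ξ i) (k : ℕ) (ω : Ω) :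
    (Fin n → Vec d) × (∀ q : (Finset.range k ×ˢ Finset.univ : Finset (ℕ × Fin n)), Ξ q.1.2) :=
  (fun i => x₀ i ω, fun q => ξ q.1.1 q.1.2 ω)

variable {Ω : Type*} {m₀ : MeasurableSpace Ω} {μ : Measure Ω}

theorem measurable_pastData {x₀ : Fin n → Ω → Vec d} {ξ : ℕ → ∀ i, Ω → Ξ i}
    (hx₀ : ∀ i, Measurable (x₀ i)) (k : ℕ) (hξ : ∀ l < k, ∀ i, Measurable (ξ l i)) :
    Measurable (pastData x₀ ξ k) :=
  (measurable_pi_lambda _ hx₀).prodMk (measurable_pi_lambda _ fun q =>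
    hξ _ (Finset.mem_range.1 (Finset.mem_product.1 q.2).1) _)

theorem measurable_initial_comap (x₀ : Fin n → Ω → Vec d) (ξ : ℕ → ∀ i, Ω → Ξ i) (k : ℕ)
    (i : Fin n) :
    Measurable[MeasurableSpace.comap (pastData x₀ ξ k) inferInstance] (x₀ i) :=
  ((measurable_pi_apply i).comp measurable_fst).comp (comap_measurable (pastData x₀ ξ k))

theorem measurable_sample_comap (x₀ : Fin n → Ω → Vec d) (ξ : ℕ → ∀ i, Ω → Ξ i) {k l : ℕ}
    (hl : l < k) (i : Fin n) :
    Measurable[MeasurableSpace.comap (pastData x₀ ξ k) inferInstance] (ξ l i) :=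
  ((measurable_pi_apply (⟨(l, i), Finset.mem_product.2
    ⟨Finset.mem_range.2 hl, Finset.mem_univ _⟩⟩ :
      (Finset.range k ×ˢ Finset.univ : Finset (ℕ × Fin n)))).comp measurable_snd).comp
    (comap_measurable (pastData x₀ ξ k))

/-- The filtration generated by the initial points and the samples. -/
def pastFiltration (x₀ : Fin n → Ω → Vec d) (ξ : ℕ → ∀ i, Ω → Ξ i)
    (hx₀ : ∀ i, Measurable (x₀ i)) (hξ : ∀ l i, Measurable (ξ l i)) : Filtration ℕ m₀ where
  seq k := MeasurableSpace.comap (pastData x₀ ξ k) inferInstance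
  mono' k k' hkk' := by
    refine Measurable.comap_le ?_
    -- Applied with the σ-algebra generated by the later data in place of the ambient one.
    exact @measurable_pastData _ _ _ _ _
      (MeasurableSpace.comap (pastData x₀ ξ k') inferInstance) _ _
      (measurable_initial_comap x₀ ξ k') k
      fun l hl i => measurable_sample_comap x₀ ξ (hl.trans_le hkk') i
  le' k := (measurable_pastData hx₀ k fun l _ i => hξ l i).comap_le

theorem indepFun_pastData [IsProbabilityMeasure μ] {x₀ : Fin n → Ω → Vec d}
    {ξ : ℕ → ∀ i, Ω → Ξ i} (h₀ : InitialCondition μ x₀ ξ) (hξ : ∀ l i, Measurable (ξ l i))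
    (hind : iIndepFun (fun p : ℕ × Fin n => ξ p.1 p.2) μ) (k : ℕ) (i : Fin n) :
    IndepFun (pastData x₀ ξ k) (ξ k i) μ := by
  set S : Finset (ℕ × Fin n) := Finset.range k ×ˢ Finset.univ with hS
  have hdisj : Disjoint S {(k, i)} := by
    rw [Finset.disjoint_singleton_right]
    simp [hS]
  have h1 := (hind.indepFun_finset S {(k, i)} hdisj fun p => hξ p.1 p.2).comp measurable_id
    (measurable_pi_apply (⟨(k, i), Finset.mem_singleton_self _⟩ : ({(k, i)} : Finset (ℕ × Fin n))))
  refine indepFun_prodMk_left (measurable_pi_lambda _ h₀.measurable)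
    (measurable_pi_lambda _ fun q => hξ _ _) (hξ k i) ?_ h1
  have hψ : Measurable fun z : (∀ p : ℕ × Fin n, Ξ p.2) => ((fun q : S => z q.1), z (k, i)) :=
    (measurable_pi_lambda _ fun q : S => measurable_pi_apply (q : ℕ × Fin n)).prodMk
      (measurable_pi_apply (k, i))
  exact h₀.indep.comp measurable_id hψ

end Samples

/-! ### The stochastic gradient errors of GT-FT as orthogonal noise. -/

section Noise

variable {n d : ℕ} {Ξ : Fin n → Type*} {Ω : Type*}
  {m₀ : MeasurableSpace Ω} {μ : Measure Ω} {F : ∀ i, Vec d → Ξ i → ℝ} {f : Fin n → Vec d → ℝ}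
  {ξ : ℕ → ∀ i, Ω → Ξ i} {L σ : ℝ}

/-- The stacked error of the stochastic gradients at the parameters `x`. -/
def gradError (F : ∀ i, Vec d → Ξ i → ℝ) (f : Fin n → Vec d → ℝ) (ξ : ℕ → ∀ i, Ω → Ξ i)
    (x : ℕ → Ω → Fin n → Vec d) (k : ℕ) (ω : Ω) : Stack n d :=
  WithLp.toLp 2 fun i => stochGrad F i (x k ω i) (ξ k i ω) - gradient (f i) (x k ω i)

theorem gradStack_add_gradError (F : ∀ i, Vec d → Ξ i → ℝ) (f : Fin n → Vec d → ℝ)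
    (ξ : ℕ → ∀ i, Ω → Ξ i) (x : ℕ → Ω → Fin n → Vec d) (k : ℕ) (ω : Ω) :
    gradStack f (WithLp.toLp 2 (x k ω)) + gradError F f ξ x k ω
      = WithLp.toLp 2 fun i => stochGrad F i (x k ω i) (ξ k i ω) := by
  ext1 i
  simp [gradStack, gradError]

theorem norm_sq_stack (v : Stack n d) : ‖v‖ ^ 2 = ∑ i, ‖v i‖ ^ 2 := PiLp.norm_sq_eq_of_L2 _ v

variable [∀ i, MeasurableSpace (Ξ i)]

theorem NoiseAssumption.memLp_gradError {x : ℕ → Ω → Fin n → Vec d}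
    (h : NoiseAssumption μ F f ξ x σ) (k : ℕ) : MemLp (gradError F f ξ x k) 2 μ :=
  MemLp.of_eval_piLp fun i => h.sqIntegrable k i

theorem history_le {x : ℕ → Ω → Fin n → Vec d} (hx : ∀ k, Measurable (x k)) (k : ℕ) :
    history x k ≤ m₀ :=
  iSup₂_le fun j _ => (hx j).comap_le

theorem measurableSet_history {x : ℕ → Ω → Fin n → Vec d} (k : ℕ) {s : Set (Fin n → Vec d)}
    (hs : MeasurableSet s) : MeasurableSet[history x k] (x k ⁻¹' s) :=
  le_iSup₂ (f := fun j (_ : j ∈ Set.Iic k) => MeasurableSpace.comap (x j) inferInstance) k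
    (Set.mem_Iic.2 le_rfl) _ ⟨s, hs, rfl⟩

/-- Events determined by `x k` lie in `history x k`, so unbiasedness can be integrated over them. -/
theorem NoiseAssumption.setIntegral_eq_zero [IsProbabilityMeasure μ] {x : ℕ → Ω → Fin n → Vec d}
    (h : NoiseAssumption μ F f ξ x σ) (hx : ∀ k, Measurable (x k)) (k : ℕ) (i : Fin n)
    (hG : Integrable (fun ω => gradient (f i) (x k ω i)) μ) {s : Set (Fin n → Vec d)}
    (hs : MeasurableSet s) :
    ∫ ω in x k ⁻¹' s, (stochGrad F i (x k ω i) (ξ k i ω) - gradient (f i) (x k ω i)) ∂μ = 0 := by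
  have he := (h.sqIntegrable k i).integrable one_le_two
  have hS : Integrable (fun ω => stochGrad F i (x k ω i) (ξ k i ω)) μ := by
    simpa only [Pi.add_def, sub_add_cancel] using he.add hG
  rw [integral_sub hS.integrableOn hG.integrableOn,
    ← setIntegral_condExp (history_le hx k) hS (measurableSet_history k hs),
    integral_congr_ae (ae_restrict_of_ae (h.unbiased k i)), sub_self]

theorem NoiseAssumption.integral_sq_le [IsProbabilityMeasure μ] {x : ℕ → Ω → Fin n → Vec d}
    (h : NoiseAssumption μ F f ξ x σ) (hx : ∀ k, Measurable (x k)) (k : ℕ) :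
    ∫ ω, ‖gradError F f ξ x k ω‖ ^ 2 ∂μ ≤ n * σ ^ 2 := by
  simp only [norm_sq_stack]
  have hint : ∀ i, Integrable (fun ω => ‖gradError F f ξ x k ω i‖ ^ 2) μ :=
    fun i => integrable_norm_sq (h.sqIntegrable k i)
  have hi : ∀ i, ∫ ω, ‖gradError F f ξ x k ω i‖ ^ 2 ∂μ ≤ σ ^ 2 := by
    intro i
    have h1 := integral_mono_ae integrable_condExp (integrable_const (σ ^ 2)) (h.variance k i)
    rw [integral_condExp (history_le hx k)] at h1
    rwa [integral_const, probReal_univ, one_smul] at h1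
  rw [integral_finsetSum _ fun i _ => hint i]
  refine (Finset.sum_le_sum fun i _ => hi i).trans ?_
  simp

theorem memLp_iter {τ : ℕ} {W : ℕ → Matrix (Fin n) (Fin n) ℝ} {α : ℝ} [IsProbabilityMeasure μ]
    {X g e : ℕ → Ω → Stack n d} (hf : SmoothBelow f L) (hL : 0 < L)
    (htrack : ∀ ω, IsTracking τ W α (fun k => X k ω) (fun k => g k ω)
      fun k => gradStack f (X k ω) + e k ω)
    (hX : MemLp (X 0) 2 μ) (he : ∀ k, MemLp (e k) 2 μ) (k : ℕ) : MemLp (X k) 2 μ := by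
  have hG : ∀ k, MemLp (X k) 2 μ → MemLp (fun ω => gradStack f (X k ω) + e k ω) 2 μ :=
    fun k hk => (memLp_comp_lipschitz (hf.lipschitz_gradStack hL) hk).add (he k)
  suffices h : MemLp (X k) 2 μ ∧ MemLp (g k) 2 μ from h.1
  induction k with
  | zero =>
    refine ⟨hX, ?_⟩
    rw [show g 0 = fun ω => gradStack f (X 0 ω) + e 0 ω from funext fun ω => (htrack ω).g_zero]
    exact hG 0 hX
  | succ k ih =>
    have hX' : MemLp (X (k + 1)) 2 μ := by
      rw [show X (k + 1) = fun ω => mixL (W (k % τ)) (X k ω - α • g k ω) from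
        funext fun ω => (htrack ω).x_succ k]
      exact (mixL (W (k % τ))).comp_memLp' (ih.1.sub (ih.2.const_smul α))
    refine ⟨hX', ?_⟩
    rw [show g (k + 1) = fun ω => mixL (W (k % τ)) (g k ω)
        + ((gradStack f (X (k + 1) ω) + e (k + 1) ω) - (gradStack f (X k ω) + e k ω)) from
      funext fun ω => (htrack ω).g_succ k]
    exact ((mixL (W (k % τ))).comp_memLp' ih.2).add ((hG _ hX').sub (hG _ ih.1))

theorem SmoothBelow.measurable_gradient (hf : SmoothBelow f L) (i : Fin n) :
    Measurable (gradient (f i)) :=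
  (LipschitzWith.of_dist_le' (K := L) fun x y => by
    simpa only [dist_eq_norm] using hf.lipschitz i x y).continuous.measurable

theorem measurable_gradError_kernel
    (hF : ∀ i, Measurable fun p : Vec d × Ξ i => stochGrad F i p.1 p.2)
    (hf : SmoothBelow f L) (i : Fin n) : Measurable fun p : (Fin n → Vec d) × Ξ i =>
      stochGrad F i (p.1 i) p.2 - gradient (f i) (p.1 i) := by
  have h1 : Measurable fun p : (Fin n → Vec d) × Ξ i => p.1 i :=
    (measurable_pi_apply i).comp measurable_fst
  have h2 : Measurable fun p : (Fin n → Vec d) × Ξ i => stochGrad F i (p.1 i) p.2 :=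
    (hF i).comp (h1.prodMk measurable_snd)
  exact h2.sub ((hf.measurable_gradient i).comp h1)

/-- `Y` may depend on earlier samples, hence need not be measurable for `history x k`. Earlier
gradient errors are of this kind, which is why conditioning on the iterates alone is not enough. -/
theorem NoiseAssumption.integral_inner_eq_zero [IsProbabilityMeasure μ]
    {x : ℕ → Ω → Fin n → Vec d} {x₀ : Fin n → Ω → Vec d} (h : NoiseAssumption μ F f ξ x σ)
    (h₀ : InitialCondition μ x₀ ξ)
    (hF : ∀ i, Measurable fun p : Vec d × Ξ i => stochGrad F i p.1 p.2)
    (hf : SmoothBelow f L) (hx : ∀ k, Measurable (x k)) {k : ℕ} {i : Fin n} {Y : Ω → Vec d}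
    (hxY : Measurable[MeasurableSpace.comap (pastData x₀ ξ k) inferInstance]
      fun ω => (x k ω, Y ω)) (hY : Measurable Y) (hY2 : MemLp Y 2 μ)
    (hG : Integrable (fun ω => gradient (f i) (x k ω i)) μ) :
    ∫ ω, inner ℝ (stochGrad F i (x k ω i) (ξ k i ω) - gradient (f i) (x k ω i)) (Y ω) ∂μ = 0 := by
  have hind : IndepFun (fun ω => (x k ω, Y ω)) (ξ k i) μ :=
    (IndepFun_iff_Indep _ _ _).2 (indep_of_indep_of_le_left
      ((IndepFun_iff_Indep _ _ _).1 (indepFun_pastData h₀ h.measurable h.indep k i))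
      hxY.comap_le)
  have he := h.sqIntegrable k i
  exact integral_inner_eq_zero_of_indepFun (φ := fun p : (Fin n → Vec d) × Ξ i =>
      stochGrad F i (p.1 i) p.2 - gradient (f i) (p.1 i)) (hx k) hY (h.measurable k i)
    (measurable_gradError_kernel hF hf i) hind (he.integrable one_le_two)
    (integrable_real_inner he hY2) fun s hs => h.setIntegral_eq_zero hx k i hG hs

/-- Evaluation of a stacked vector at one agent. -/
abbrev agent (n d : ℕ) (i : Fin n) : Stack n d →L[ℝ] Vec d := PiLp.proj 2 (fun _ => Vec d) i

theorem NoiseAssumption.isNoise [IsProbabilityMeasure μ] {x : ℕ → Ω → Fin n → Vec d}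
    {x₀ : Fin n → Ω → Vec d} (h : NoiseAssumption μ F f ξ x σ) (h₀ : InitialCondition μ x₀ ξ)
    (hF : ∀ i, Measurable fun p : Vec d × Ξ i => stochGrad F i p.1 p.2)
    (hf : SmoothBelow f L)
    (hxm : ∀ k, Measurable[pastFiltration x₀ ξ h₀.measurable h.measurable k] (x k))
    (hx : ∀ k, MemLp (fun ω => (WithLp.toLp 2 (x k ω) : Stack n d)) 2 μ) :
    IsNoise μ (pastFiltration x₀ ξ h₀.measurable h.measurable) (gradError F f ξ x) := by
  have hx' : ∀ k, Measurable (x k) := fun k => (hxm k).mono (Filtration.le _ k) le_rfl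
  refine ⟨h.memLp_gradError, fun k => ?_, fun k Y hY hY2 => ?_⟩
  · refine measurable_toLp_pi fun i => ?_
    exact (measurable_gradError_kernel hF hf i).comp
      (((hxm k).mono (Filtration.mono _ k.le_succ) le_rfl).prodMk
        (measurable_sample_comap x₀ ξ k.lt_succ_self i))
  · have hY2i : ∀ i, MemLp (fun ω => Y ω i) 2 μ := fun i => (agent n d i).comp_memLp' hY2
    have hYi : ∀ i, Measurable[pastFiltration x₀ ξ h₀.measurable h.measurable k]
        fun ω => Y ω i := fun i => (agent n d i).continuous.measurable.comp hY
    have hG : ∀ i, Integrable (fun ω => gradient (f i) (x k ω i)) μ := fun i => by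
      have h1 : MemLp (fun ω => x k ω i) 2 μ := (agent n d i).comp_memLp' (hx k)
      exact (memLp_comp_lipschitz (hf.lipschitz i) h1).integrable one_le_two
    have hi : ∀ ω, inner ℝ (gradError F f ξ x k ω) (Y ω) = ∑ i,
        inner ℝ (stochGrad F i (x k ω i) (ξ k i ω) - gradient (f i) (x k ω i)) (Y ω i) :=
      fun ω => PiLp.inner_apply _ _
    simp only [hi]
    rw [integral_finsetSum _ fun i _ => integrable_real_inner (h.sqIntegrable k i) (hY2i i)]
    exact Finset.sum_eq_zero fun i _ => h.integral_inner_eq_zero h₀ hF hf hx'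
      ((hxm k).prodMk (hYi i)) ((hYi i).mono (Filtration.le _ k) le_rfl) (hY2i i) (hG i)

theorem measurable_iter_past (F : ∀ i, Vec d → Ξ i → ℝ) (τ : ℕ)
    (W : ℕ → Matrix (Fin n) (Fin n) ℝ) (α : ℝ) (x₀ : Fin n → Ω → Vec d) (ξ : ℕ → ∀ i, Ω → Ξ i)
    (hF : ∀ i, Measurable fun p : Vec d × Ξ i => stochGrad F i p.1 p.2) (k : ℕ) :
    Measurable[MeasurableSpace.comap (pastData x₀ ξ k) inferInstance]
      (iter F τ W α x₀ ξ k) := by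
  let _ := MeasurableSpace.comap (pastData x₀ ξ k) inferInstance
  have hm : Measurable fun ω i => x₀ i ω :=
    measurable_pi_lambda _ fun i => measurable_initial_comap x₀ ξ k i
  exact (measurable_state hF hm k fun l hl i => measurable_sample_comap x₀ ξ hl i).1

theorem initialDisagreement_eq {x₀ : Fin n → Ω → Vec d} {X : Ω → Stack n d}
    (hX : ∀ ω i, X ω i = x₀ i ω) (hX2 : MemLp X 2 μ) :
    (n : ℝ)⁻¹ * ∫ ω, ‖center n d (X ω)‖ ^ 2 ∂μ = initialDisagreement μ x₀ := by
  have hc : ∀ ω i, center n d (X ω) i = x₀ i ω - avg fun j => x₀ j ω := fun ω i => by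
    simp only [center_apply, ← hX]
  rw [initialDisagreement, ← integral_finsetSum]
  · simp only [norm_sq_stack, hc]
  · intro i _
    simp only [← hc]
    exact integrable_norm_sq ((agent n d i).comp_memLp' ((center n d).comp_memLp' hX2))

theorem initialGradSpread_eq {x₀ : Fin n → Ω → Vec d} {X : Ω → Stack n d}
    (hX : ∀ ω i, X ω i = x₀ i ω) (hX2 : MemLp (fun ω => gradStack f (X ω)) 2 μ) :
    (n : ℝ)⁻¹ * ∫ ω, ‖center n d (gradStack f (X ω))‖ ^ 2 ∂μ = initialGradSpread μ f x₀ := by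
  have hc : ∀ ω i, center n d (gradStack f (X ω)) i
      = gradient (f i) (x₀ i ω) - avg fun j => gradient (f j) (x₀ j ω) := fun ω i => by
    simp only [center_apply, ← hX, gradStack]
  rw [initialGradSpread, ← integral_finsetSum]
  · simp only [norm_sq_stack, hc]
  · intro i _
    simp only [← hc]
    exact integrable_norm_sq ((agent n d i).comp_memLp' ((center n d).comp_memLp' hX2))

theorem initialGap_eq {x₀ : Fin n → Ω → Vec d} {X : Ω → Stack n d}
    (hX : ∀ ω i, X ω i = x₀ i ω) :
    (∫ ω, globalObj f (avg (X ω).ofLp) ∂μ) - ⨅ y, globalObj f y = initialGap μ f x₀ := by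
  have hc : ∀ ω, (X ω).ofLp = fun i => x₀ i ω := fun ω => funext (hX ω)
  simp only [initialGap, hc]

/-- Summed stationarity bound for GT-FT. -/
theorem NoiseAssumption.sum_stationarity_le [IsProbabilityMeasure μ] {τ : ℕ} {α : ℝ}
    {W : ℕ → Matrix (Fin n) (Fin n) ℝ} {x : ℕ → Ω → Fin n → Vec d} {x₀ : Fin n → Ω → Vec d}
    (h : NoiseAssumption μ F f ξ x σ) (h₀ : InitialCondition μ x₀ ξ)
    (hF : ∀ i, Measurable fun p : Vec d × Ξ i => stochGrad F i p.1 p.2)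
    (hf : SmoothBelow f L) (hn : 0 < n) (hL : 0 < L) (hα : 0 < α)
    (hstep : α ≤ 1 / (4 * √3 * (τ : ℝ) ^ 2 * L)) (hW : FiniteTimeConsensus τ W)
    (hx : x = iter F τ W α x₀ ξ) :
    (∀ k, Integrable (fun ω => ‖avg fun i => gradient (f i) (x k ω i)‖ ^ 2) μ ∧
      Integrable (fun ω => ‖gradient (globalObj f) (avg (x k ω))‖ ^ 2) μ) ∧
    ∀ N : ℕ, ∑ k ∈ Finset.range N, ((∫ ω, ‖avg fun i => gradient (f i) (x k ω i)‖ ^ 2 ∂μ)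
        + ∫ ω, ‖gradient (globalObj f) (avg (x k ω))‖ ^ 2 ∂μ)
      ≤ 48 * (initialGap μ f x₀ / α + L ^ 2 * (τ * initialDisagreement μ x₀
          + α ^ 2 * (τ : ℝ) ^ 3 * initialGradSpread μ f x₀)) + 18 * (N * (σ ^ 2 / τ)) := by
  set X : ℕ → Ω → Stack n d := fun k ω => WithLp.toLp 2 (x k ω) with hX
  set g : ℕ → Ω → Stack n d := fun k ω =>
    WithLp.toLp 2 (state F τ W α (fun i => x₀ i ω) (fun j i => ξ j i ω) k).2
  have htrack : ∀ ω, IsTracking τ W α (fun k => X k ω) (fun k => g k ω)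
      fun k => gradStack f (X k ω) + gradError F f ξ x k ω := by
    intro ω
    simp only [hX, gradStack_add_gradError]
    subst hx
    exact isTracking_state F τ W α (fun i => x₀ i ω) fun j i => ξ j i ω
  have hx0 : ∀ ω i, X 0 ω i = x₀ i ω := fun ω i => by simp only [hX, hx]; rfl
  have hX0 : MemLp (X 0) 2 μ := MemLp.of_eval_piLp fun i => by
    simpa only [hx0] using h₀.memLp i
  have hXm : ∀ k, MemLp (X k) 2 μ := memLp_iter hf hL htrack hX0 h.memLp_gradError
  have hxm : ∀ k, Measurable[pastFiltration x₀ ξ h₀.measurable h.measurable k] (x k) := by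
    intro k
    have hm := measurable_iter_past F τ W α x₀ ξ hF k
    rwa [← hx] at hm
  have hnoise := h.isNoise h₀ hF hf hxm hXm
  have hVar := h.integral_sq_le fun k => (hxm k).mono (Filtration.le _ k) le_rfl
  have hG : ∀ k, MemLp (fun ω => gradStack f (X k ω)) 2 μ :=
    fun k => memLp_comp_lipschitz (hf.lipschitz_gradStack hL) (hXm k)
  have hXmeas : ∀ k, Measurable[pastFiltration x₀ ξ h₀.measurable h.measurable k] (X k) :=
    fun k => measurable_toLp_pi fun i => (measurable_pi_apply i).comp (hxm k)
  have hGavg : ∀ k, MemLp (fun ω => avg (gradStack f (X k ω)).ofLp) 2 μ :=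
    fun k => memLp_avg hn (hG k)
  have hXavg : ∀ k, MemLp (fun ω => avg (X k ω).ofLp) 2 μ := fun k => memLp_avg hn (hXm k)
  have hgrad : ∀ k, MemLp (fun ω => gradient (globalObj f) (avg (X k ω).ofLp)) 2 μ :=
    fun k => memLp_comp_lipschitz (g := gradient (globalObj f)) (hf.lipschitz_globalObj hn)
      (hXavg k)
  refine ⟨fun k => ⟨integrable_norm_sq (hGavg k), integrable_norm_sq (hgrad k)⟩, fun N => ?_⟩
  have hmain := GTFT.sum_stationarity_le hf hn hL hα hW hstep htrack hXm hXmeas hnoise hVar N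
  rw [initialGap_eq hx0, initialDisagreement_eq hx0 hX0, initialGradSpread_eq hx0 (hG 0)] at hmain
  exact hmain

end Noise

end GTFT

end

/-! ### The theorem: normalisation of the summed bound. -/

theorem mainTheorem1 :
    -- absolute constants
    ∃ c γ₂ γ₃ : ℝ, 0 < c ∧ 0 < γ₂ ∧ 0 < γ₃ ∧
    ∀ (n d τ : ℕ) (L σ α : ℝ), 0 < n → 0 < L → 0 < σ →
    0 < α → α ≤ 1 / (4 * √3 * (τ : ℝ) ^ 2 * L) →
    -- the problem, given by the loss functions and the data distributions
    ∀ (Ξ : Fin n → Type*) [∀ i, MeasurableSpace (Ξ i)]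
      (P : ∀ i, Measure (Ξ i)) [∀ i, IsProbabilityMeasure (P i)]
      (F : ∀ i, GTFT.Vec d → Ξ i → ℝ) (f : Fin n → GTFT.Vec d → ℝ),
    f = GTFT.localObj P F →
    GTFT.LossRegular P F →
    GTFT.SmoothBelow f L →
    -- the mixing matrices
    ∀ (W : ℕ → Matrix (Fin n) (Fin n) ℝ), GTFT.FiniteTimeConsensus τ W →
    -- the initial points, the samples and the iterates
    ∀ (Ω : Type*) [MeasurableSpace Ω] (μ : Measure Ω) [IsProbabilityMeasure μ]
      (x₀ : Fin n → Ω → GTFT.Vec d) (ξ : ℕ → ∀ i, Ω → Ξ i)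
      (x : ℕ → Ω → Fin n → GTFT.Vec d),
    x = GTFT.iter F τ W α x₀ ξ →
    GTFT.InitialCondition μ x₀ ξ →
    GTFT.NoiseAssumption μ F f ξ x σ →
    -- the expectations below are those of integrable random variables
    (∀ k,
      Integrable (fun ω => ‖GTFT.avg fun i => gradient (f i) (x k ω i)‖ ^ 2) μ ∧
      Integrable (fun ω => ‖gradient (GTFT.globalObj f) (GTFT.avg (x k ω))‖ ^ 2) μ) ∧
    -- the rate: `γ₁` depends only on the initial data, `L`, `τ` and `α`
    ∀ γ₁ : ℝ, 0 < γ₁ →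
      c * (GTFT.initialGap μ f x₀ / (α * (τ : ℝ) ^ 2 * L ^ 2)
          + GTFT.initialDisagreement μ x₀ / τ
          + α ^ 2 * τ * GTFT.initialGradSpread μ f x₀) ≤ γ₁ →
      ∀ T : ℕ, τ ≤ T →
        1 / ((T : ℝ) + 1) * ∑ k ∈ Finset.range (T + 1),
          ((∫ ω, ‖GTFT.avg fun i => gradient (f i) (x k ω i)‖ ^ 2 ∂μ)
            + ∫ ω, ‖gradient (GTFT.globalObj f) (GTFT.avg (x k ω))‖ ^ 2 ∂μ)
        ≤ γ₁ * (τ : ℝ) ^ 2 * L ^ 2 / T + γ₂ * σ ^ 2 / τ + γ₃ * σ ^ 2 / ((τ : ℝ) ^ 2 * n) := by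
  -- `48` and `18` come from `stationarity_bound`. The term in `γ₃` is pure slack, so any positive
  -- value serves.
  refine ⟨48, 18, 1, by norm_num, by norm_num, by norm_num, ?_⟩
  intro n d τ L σ α hn hL _ hα hstep Ξ _ P _ F f _ hreg hf W hW Ω _ μ _ x₀ ξ x hx h₀ h
  obtain ⟨hint, hsum⟩ :=
    h.sum_stationarity_le h₀ hreg.measurable_grad hf hn hL hα hstep hW hx
  refine ⟨hint, ?_⟩
  intro γ₁ _ hγ₁ T hT
  have hτ : (0 : ℝ) < τ := by exact_mod_cast hW.one_le
  have hT0 : (0 : ℝ) < T := by exact_mod_cast lt_of_lt_of_le hW.one_le hT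
  have hT1 : (0 : ℝ) < (T : ℝ) + 1 := by linarith
  -- The times `0, …, T` are `T + 1` in number, which cancels the normalisation in the noise term.
  have hmain := hsum (T + 1)
  generalize GTFT.initialGap μ f x₀ = Δ at *
  generalize GTFT.initialDisagreement μ x₀ = D at *
  generalize GTFT.initialGradSpread μ f x₀ = G at *
  have hinit : 48 * (Δ / α + L ^ 2 * (τ * D + α ^ 2 * (τ : ℝ) ^ 3 * G))
      ≤ γ₁ * (τ : ℝ) ^ 2 * L ^ 2 := by
    calc 48 * (Δ / α + L ^ 2 * (τ * D + α ^ 2 * (τ : ℝ) ^ 3 * G))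
        = 48 * (Δ / (α * (τ : ℝ) ^ 2 * L ^ 2) + D / τ + α ^ 2 * τ * G)
            * ((τ : ℝ) ^ 2 * L ^ 2) := by
          field_simp
          ring
      _ ≤ γ₁ * ((τ : ℝ) ^ 2 * L ^ 2) := mul_le_mul_of_nonneg_right hγ₁ (by positivity)
      _ = _ := by ring
  push_cast at hmain
  have hbound := hmain.trans (add_le_add hinit le_rfl)
  calc _ ≤ 1 / ((T : ℝ) + 1) * (γ₁ * (τ : ℝ) ^ 2 * L ^ 2
          + 18 * (((T : ℝ) + 1) * (σ ^ 2 / τ))) :=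
        mul_le_mul_of_nonneg_left hbound (by positivity)
    _ = γ₁ * (τ : ℝ) ^ 2 * L ^ 2 / ((T : ℝ) + 1) + 18 * σ ^ 2 / τ := by field_simp
    _ ≤ γ₁ * (τ : ℝ) ^ 2 * L ^ 2 / T + 18 * σ ^ 2 / τ := by
        gcongr
        linarith
    _ ≤ _ := le_add_of_nonneg_right (by positivity)
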